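/- Let $g\ge 2$ and $n>1$ be integers, let $\mathcal H_g$ be the Siegel upper half-space of symmetric complex $g\times g$ matrices with positive definite imaginary part, and for $\varepsilon,\delta\in\mathbb R^g$, $\tau\in\mathcal H_g$, $z\in\mathbb C^g$ put $$\theta\!\left[\begin{smallmatrix}\varepsilon\\ \delta\end{smallmatrix}\right](\tau,z)=\sum_{m\in\mathbb Z^g}\mathbf e\!\left(\tfrac12(m+\varepsilon)^t\tau(m+\varepsilon)+(m+\varepsilon)^t(z+\delta)\right),\qquad \mathbf e(t)=\exp(2\pi i t),$$ which depends on $\varepsilon$ only modulo $\mathbb Z^g$; write $\theta\!\left[\begin{smallmatrix}\varepsilon\\ \delta\end{smallmatrix}\right](\tau)$ for its value at $z=0$. For $\tau\in\mathcal H_g$ let $\Phi_{4n}(\tau)\subset\mathbb C^{(4n)^g}$ be the subspace spanned by the $g$ rows of the $g\times(4n)^g$ matrix with columns $$\operatorname{grad}_{z=0}\theta\!\left[\begin{smallmatrix}a\\ 0\end{smallmatrix}\right](4n\tau,z),\qquad a\in(\tfrac1{4n}\mathbb Z)^g/\mathbb Z^g .$$ Then $\Phi_{4n}(\tau)$ has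 dimension $g$ for every $\tau\in\mathcal H_g$, so that $\Phi_{4n}(\tau)$ is a point of the Grassmannian $G(g,(4n)^g)$ of $g$-planes in $\mathbb C^{(4n)^g}$, and for all fixed $\gamma,\delta\in(\tfrac12\mathbb Z)^g$ (arbitrary representatives of classes in $(\tfrac12\mathbb Z/\mathbb Z)^g$) the vector $$P_{\gamma,\delta}(\tau):=\left(\theta\!\left[\begin{smallmatrix}a+\frac{\delta}{2n}\\ \gamma\end{smallmatrix}\right](2n\tau)\right)_{a\in(\frac1{2n}\mathbb Z)^g/\mathbb Z^g}$$ is non-zero for every $\tau\in\mathcal H_g$, and its class $[P_{\gamma,\delta}(\tau)]\in\mathbb P^{(2n)^g-1}$ is uniquely determined by $\Phi_{4n}(\tau)$: if $\tau,\tau'\in\mathcal H_g$ and $\Phi_{4n}(\tau)=\Phi_{4n}(\tau')$, then $[P_{\gamma,\delta}(\tau)]=[P_{\gamma,\delta}(\tau')]$. For $\gamma=\delta=0$ this projective point is $Th_{2n}(\tau):=\left[\theta\!\left[\begin{smallmatrix}a\\ 0\end{smallmatrix}\right](2n\tau)\right]_{a\in(\frac1{2n}\mathbb Z)^g/\mathbb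 Z^g}$. -/

import Mathlib

open scoped Matrix LinearAlgebra.Projectivization

noncomputable section

/-- The Siegel upper half-space of degree `g`: symmetric complex `g × g` matrices with positive
definite imaginary part. -/
def SiegelUpperHalfSpace (g : ℕ) : Type :=
  {τ : Matrix (Fin g) (Fin g) ℂ // τ.IsSymm ∧ (τ.map Complex.im).PosDef}

/-- The general term of the theta series with characteristics `ε, δ`, for the vector
`v = m + ε` with `m ∈ ℤ^g`:  `e(½ vᵗ τ v + vᵗ (z + δ))`, where `e(t) = exp(2πit)`. -/
def thetaTerm {g : ℕ} (τ : Matrix (Fin g) (Fin g) ℂ) (ε δ : Fin g → ℝ) (z : Fin g → ℂ)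
    (m : Fin g → ℤ) : ℂ :=
  let v : Fin g → ℂ := fun i => (m i : ℂ) + (ε i : ℂ)
  Complex.exp (2 * (Real.pi : ℂ) * Complex.I *
    (1 / 2 * (v ⬝ᵥ (τ *ᵥ v)) + v ⬝ᵥ (fun i => z i + (δ i : ℂ))))

/-- The theta function `θ[ε, δ](τ, z)` with characteristics `ε, δ ∈ ℝ^g`. -/
def theta {g : ℕ} (τ : Matrix (Fin g) (Fin g) ℂ) (ε δ : Fin g → ℝ) (z : Fin g → ℂ) : ℂ :=
  ∑' m : Fin g → ℤ, thetaTerm τ ε δ z m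

/-- The theta function depends on its upper characteristic only modulo `ℤ^g`. -/
theorem theta_add_int {g : ℕ} (τ : Matrix (Fin g) (Fin g) ℂ) (ε δ : Fin g → ℝ)
    (z : Fin g → ℂ) (k : Fin g → ℤ) :
    theta τ (fun i => ε i + (k i : ℝ)) δ z = theta τ ε δ z := by
  unfold theta
  rw [← (Equiv.addRight k).tsum_eq (fun m => thetaTerm τ ε δ z m)]
  refine tsum_congr fun m => ?_
  have h : (fun i => (m i : ℂ) + ((ε i + (k i : ℝ) : ℝ) : ℂ)) =
      fun i => (((Equiv.addRight k) m i : ℤ) : ℂ) + (ε i : ℂ) := by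
    funext i
    simp only [Equiv.coe_addRight, Pi.add_apply]
    push_cast
    ring
  simp only [thetaTerm, h]

/-- The group `(1/m)ℤ^g / ℤ^g` is indexed by `(ℤ/m)^g`; this is the representative in `[0, 1)^g` of
the class with index `a`. The choice of representative does not matter, by `theta_add_int`. -/
def levelChar {g : ℕ} (m : ℕ) (a : Fin g → ZMod m) : Fin g → ℝ :=
  fun i => ((a i).val : ℝ) / (m : ℝ)

/-- The partial derivative `∂θ[a, 0](mτ, z)/∂z_i` at `z = 0`, for `a ∈ (1/m)ℤ^g / ℤ^g`. -/
def thetaGrad {g : ℕ} (m : ℕ) (τ : SiegelUpperHalfSpace g) (i : Fin g)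
    (a : Fin g → ZMod m) : ℂ :=
  deriv (fun t : ℂ => theta ((m : ℂ) • τ.1) (levelChar m a) 0 (Pi.single i t)) 0

/-- The gradient map of level `m`: the subspace of `ℂ^(m^g)` spanned by the `g` rows of the matrix
whose columns are the gradients at `z = 0` of all the `θ[a, 0](mτ, z)`. -/
def gradientMap {g : ℕ} (m : ℕ) (τ : SiegelUpperHalfSpace g) :
    Submodule ℂ ((Fin g → ZMod m) → ℂ) :=
  Submodule.span ℂ (Set.range (thetaGrad m τ))

/-- The vector of theta constants `θ[a, 0](mτ, 0)`, for all `a ∈ (1/m)ℤ^g / ℤ^g`. -/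
def thetaConstants {g : ℕ} (m : ℕ) (τ : SiegelUpperHalfSpace g) : (Fin g → ZMod m) → ℂ :=
  fun a => theta ((m : ℂ) • τ.1) (levelChar m a) 0 0

/-- The vector of theta constants `θ[a + δ/(2n), γ](2nτ, 0)`, for all `a ∈ (1/2n)ℤ^g / ℤ^g`, where
`γ = c/2` and `δ = d/2` with `c, d ∈ ℤ^g`. -/
def shiftedThetaConstants {g : ℕ} (n : ℕ) (c d : Fin g → ℤ) (τ : SiegelUpperHalfSpace g) :
    (Fin g → ZMod (2 * n)) → ℂ :=
  fun a => theta (((2 * n : ℕ) : ℂ) • τ.1)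
    (fun i => levelChar (2 * n) a i + ((d i : ℝ) / 2) / (2 * n)) (fun i => (c i : ℝ) / 2) 0

end

/-! Let F be the vector P_{γ,δ}(τ), and let Q(v) collect the second derivatives at γ, in direction
v, of the functions whose values form F. The addition formula writes a product of two such functions
at γ + (t+s)v and γ + (t-s)v as a sum of products of level 4n theta functions, one factor in t and
one in s. Applying ∂_t∂_s at 0 expresses the bivector F ∧ Q(v) bilinearly in the gradients of level
4n, with coefficients independent of τ (`shiftedSecondDeriv_wedge`). Hence Φ_{4n}(τ) determines the
set of all F ∧ Q(v).

The rest depends on anisotropy: Q(v) ∈ ℂF only for v = 0 (`eq_zero_of_shiftedSecondDeriv_eq`). A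
linear relation among the gradient rows would give F ∧ Q(v) = 0 with v ≠ 0, so the dimension is g.
If τ' has the same Φ but F' is not proportional to F, every Q(v) lies in the span of F and F';
modulo F it is a scalar quadratic form, which over ℂ has a nonzero isotropic vector as soon as g ≥
2, a contradiction (`exists_smul_eq_of_wedge_eq`).

Anisotropy comes from `eq_zero_of_theta_levelChar_jet_eq_zero`. Products of N = 2n translates of θ
with a fixed sum of shifts lie in the span of the level N functions. If all of these satisfy one
second order equation at a point, then, four shifts being free because n > 1, certain Wronskians
vanish: the increments of the logarithmic derivative of θ along v do not depend on the base point.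
Periodicity under ℤ^g makes this logarithmic derivative constant, while translation by the columns
of τ changes it by multiples of 2πi v_j; hence v = 0. -/

/-! ### Summability over ℤ^g and coercivity of positive definite forms -/

theorem summable_pi_prod {f : ℤ → ℝ} (hf : Summable f) (hf0 : ∀ m, 0 ≤ f m) (g : ℕ) :
    Summable fun m : Fin g → ℤ => ∏ i, f (m i) := by
  induction g with
  | zero => exact Summable.of_finite
  | succ g ih =>
    rw [← (Fin.consEquiv fun _ => ℤ).summable_iff]
    have h := hf.mul_of_nonneg ih hf0 (fun m => Finset.prod_nonneg fun i _ => hf0 _)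
    refine h.congr fun p => ?_
    simp [Fin.prod_univ_succ, Fin.consEquiv]

theorem summable_exp_neg_abs_int : Summable fun m : ℤ => Real.exp (-|(m : ℝ)|) := by
  refine Summable.of_nat_of_neg ?_ ?_ <;>
    simpa using Real.summable_exp_neg_nat

/-- Compactness of the unit sphere gives a positive minimum. The norm on `Fin g → ℝ` is the sup
norm, and the sum of squares is at most g times its square; hence the division by g in the constant.
-/
theorem Matrix.PosDef.exists_coercive {g : ℕ} {Y : Matrix (Fin g) (Fin g) ℝ} (hY : Y.PosDef) :
    ∃ c : ℝ, 0 < c ∧ ∀ v : Fin g → ℝ, c * ∑ i, v i ^ 2 ≤ v ⬝ᵥ (Y *ᵥ v) := by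
  have hpos : ∀ v : Fin g → ℝ, v ≠ 0 → 0 < v ⬝ᵥ (Y *ᵥ v) := fun v hv => by
    simpa using hY.dotProduct_mulVec_pos hv
  rcases Nat.eq_zero_or_pos g with rfl | hg
  · exact ⟨1, one_pos, fun v => by simp⟩
  have : Nonempty (Fin g) := ⟨⟨0, hg⟩⟩
  have hcont : Continuous fun v : Fin g → ℝ => v ⬝ᵥ (Y *ᵥ v) := by fun_prop
  obtain ⟨w, hw, hmin⟩ := (isCompact_sphere (0 : Fin g → ℝ) 1).exists_isMinOn
    (NormedSpace.sphere_nonempty.mpr zero_le_one) hcont.continuousOn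
  have hw1 : ‖w‖ = 1 := by simpa using hw
  have hw0 : w ≠ 0 := by rintro rfl; simp at hw1
  have hm := hpos w hw0
  have hg' : (0 : ℝ) < g := by exact_mod_cast hg
  refine ⟨(w ⬝ᵥ (Y *ᵥ w)) / g, by positivity, fun v => ?_⟩
  by_cases hv : v = 0
  · subst hv; simp
  have hv' : 0 < ‖v‖ := norm_pos_iff.mpr hv
  have hu : ‖v‖⁻¹ • v ∈ Metric.sphere (0 : Fin g → ℝ) 1 := by
    simp [norm_smul, hv'.ne']
  have h1 := hmin hu
  simp only [Set.mem_ofPred_eq, Matrix.mulVec_smul, dotProduct_smul, smul_dotProduct,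
    smul_eq_mul] at h1
  have h2 : (w ⬝ᵥ (Y *ᵥ w)) * ‖v‖ ^ 2 ≤ v ⬝ᵥ (Y *ᵥ v) := by
    calc _ ≤ (‖v‖⁻¹ * (‖v‖⁻¹ * v ⬝ᵥ (Y *ᵥ v))) * ‖v‖ ^ 2 := by gcongr
      _ = _ := by field_simp
  have h3 : ∑ i, v i ^ 2 ≤ g * ‖v‖ ^ 2 := by
    have : ∀ i ∈ Finset.univ, v i ^ 2 ≤ ‖v‖ ^ 2 := fun i _ => by
      rw [← sq_abs]
      have := norm_le_pi_norm v i
      rw [Real.norm_eq_abs] at this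
      gcongr
    simpa using Finset.sum_le_card_nsmul _ _ _ this
  calc _ ≤ (w ⬝ᵥ (Y *ᵥ w)) / g * (g * ‖v‖ ^ 2) := by gcongr
    _ = (w ⬝ᵥ (Y *ᵥ w)) * ‖v‖ ^ 2 := by field_simp
    _ ≤ _ := h2

/-! ### Exponential series and their directional derivatives -/

section ExpSum

variable {ι : Type*} {g : ℕ}

/-- The exponent `2πi ν·z` attached to a real frequency `ν`. -/
noncomputable def freqPairing (ν : Fin g → ℝ) (z : Fin g → ℂ) : ℂ :=
  2 * (Real.pi : ℂ) * Complex.I * ∑ j, (ν j : ℂ) * z j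

theorem freqPairing_add (ν : Fin g → ℝ) (z w : Fin g → ℂ) :
    freqPairing ν (z + w) = freqPairing ν z + freqPairing ν w := by
  simp [freqPairing, mul_add, Finset.sum_add_distrib]

theorem freqPairing_smul (ν : Fin g → ℝ) (t : ℂ) (z : Fin g → ℂ) :
    freqPairing ν (t • z) = t * freqPairing ν z := by
  simp only [freqPairing, Pi.smul_apply, smul_eq_mul, Finset.mul_sum]
  exact Finset.sum_congr rfl fun _ _ => by ring

theorem norm_freqPairing_le (ν : Fin g → ℝ) (z : Fin g → ℂ) :
    ‖freqPairing ν z‖ ≤ 2 * Real.pi * ‖z‖ * ∑ j, |ν j| := by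
  have h : ‖∑ j, (ν j : ℂ) * z j‖ ≤ ∑ j, |ν j| * ‖z‖ := by
    refine norm_sum_le_of_le _ fun j _ => ?_
    rw [norm_mul, Complex.norm_real, Real.norm_eq_abs]
    gcongr
    exact norm_le_pi_norm z j
  rw [← Finset.sum_mul] at h
  calc ‖freqPairing ν z‖ = 2 * Real.pi * ‖∑ j, (ν j : ℂ) * z j‖ := by
        simp [freqPairing, abs_of_pos Real.pi_pos]
    _ ≤ 2 * Real.pi * ((∑ j, |ν j|) * ‖z‖) := by gcongr
    _ = _ := by ring

/-- The exponential series with coefficients `κ` and frequencies `ν`. -/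
noncomputable def expSum (ν : ι → Fin g → ℝ) (κ : ι → ℂ) (z : Fin g → ℂ) : ℂ :=
  ∑' i, κ i * Complex.exp (freqPairing (ν i) z)

/-- Coefficients that decay faster than any exponential in the size of the frequency. -/
def RapidDecay (ν : ι → Fin g → ℝ) (κ : ι → ℂ) : Prop :=
  ∀ R : ℝ, Summable fun i => ‖κ i‖ * Real.exp (R * ∑ j, |ν i j|)

/-- The coefficients of the derivative in the direction `v`. -/
noncomputable def dirDeriv (ν : ι → Fin g → ℝ) (v : Fin g → ℂ) (κ : ι → ℂ) : ι → ℂ :=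
  fun i => κ i * freqPairing (ν i) v

variable {ν : ι → Fin g → ℝ} {κ κ' : ι → ℂ}

/-- The linear factor is absorbed by x ≤ exp x at the cost of a larger R, which is why decay is
required for every R. -/
theorem RapidDecay.dirDeriv (h : RapidDecay ν κ) (v : Fin g → ℂ) :
    RapidDecay ν (dirDeriv ν v κ) := by
  intro R
  refine Summable.of_nonneg_of_le (fun i => by positivity) (fun i => ?_)
    (h (2 * Real.pi * ‖v‖ + R))
  rw [_root_.dirDeriv, norm_mul, mul_assoc, add_mul, Real.exp_add]
  gcongr
  exact (norm_freqPairing_le _ _).trans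
    (by linarith [Real.add_one_le_exp (2 * Real.pi * ‖v‖ * ∑ j, |ν i j|)])

theorem norm_term_le (ν : Fin g → ℝ) (k : ℂ) (z : Fin g → ℂ) {r : ℝ} (hr : ‖z‖ ≤ r) :
    ‖k * Complex.exp (freqPairing ν z)‖ ≤ ‖k‖ * Real.exp (2 * Real.pi * r * ∑ j, |ν j|) := by
  rw [norm_mul]
  gcongr
  refine (Complex.norm_exp_le_exp_norm _).trans (Real.exp_le_exp.mpr ?_)
  refine (norm_freqPairing_le _ _).trans ?_
  have : 0 ≤ ∑ j, |ν j| := Finset.sum_nonneg fun _ _ => abs_nonneg _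
  gcongr

theorem RapidDecay.summable (h : RapidDecay ν κ) (z : Fin g → ℂ) :
    Summable fun i => κ i * Complex.exp (freqPairing (ν i) z) :=
  Summable.of_norm_bounded (h (2 * Real.pi * ‖z‖)) fun _ => norm_term_le _ _ _ le_rfl

theorem RapidDecay.summable_norm (h : RapidDecay ν κ) (z : Fin g → ℂ) :
    Summable fun i => ‖κ i * Complex.exp (freqPairing (ν i) z)‖ :=
  Summable.of_nonneg_of_le (fun _ => norm_nonneg _) (fun _ => norm_term_le _ _ _ le_rfl)
    (h (2 * Real.pi * ‖z‖))

theorem expSum_add (h : RapidDecay ν κ) (h' : RapidDecay ν κ') (z : Fin g → ℂ) :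
    expSum ν (κ + κ') z = expSum ν κ z + expSum ν κ' z := by
  simp only [expSum, Pi.add_apply, add_mul]
  exact (h.summable z).tsum_add (h'.summable z)

theorem expSum_smul (c : ℂ) (z : Fin g → ℂ) :
    expSum ν (c • κ) z = c * expSum ν κ z := by
  simp only [expSum, Pi.smul_apply, smul_eq_mul, mul_assoc]
  exact tsum_mul_left

theorem dirDeriv_add (v w : Fin g → ℂ) :
    dirDeriv ν (v + w) κ = dirDeriv ν v κ + dirDeriv ν w κ := by
  ext i
  simp [dirDeriv, freqPairing_add, mul_add]

theorem dirDeriv_smul (c : ℂ) (v : Fin g → ℂ) :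
    dirDeriv ν (c • v) κ = c • dirDeriv ν v κ := by
  ext i
  simp only [dirDeriv, freqPairing_smul, Pi.smul_apply, smul_eq_mul]
  ring

theorem dirDeriv_comm (v w : Fin g → ℂ) :
    dirDeriv ν v (dirDeriv ν w κ) = dirDeriv ν w (dirDeriv ν v κ) := by
  ext i
  simp only [dirDeriv]
  ring

theorem hasDerivAt_expSum (h : RapidDecay ν κ) (p w : Fin g → ℂ) (t : ℂ) :
    HasDerivAt (fun s : ℂ => expSum ν κ (p + s • w)) (expSum ν (dirDeriv ν w κ) (p + t • w)) t := by
  obtain ⟨r, hr⟩ : ∃ r : ℝ, ‖t‖ < r := ⟨‖t‖ + 1, by linarith⟩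
  have ht : t ∈ Metric.ball (0 : ℂ) r := by simpa using hr
  have hterm : ∀ (i : ι) (s : ℂ), s ∈ Metric.ball (0 : ℂ) r → HasDerivAt
      (fun s : ℂ => κ i * Complex.exp (freqPairing (ν i) (p + s • w)))
      (dirDeriv ν w κ i * Complex.exp (freqPairing (ν i) (p + s • w))) s := by
    intro i s _
    have h1 : HasDerivAt (fun s : ℂ => freqPairing (ν i) (p + s • w)) (freqPairing (ν i) w) s := by
      simp only [freqPairing_add, freqPairing_smul]
      simpa using ((hasDerivAt_id s).mul_const (freqPairing (ν i) w)).const_add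
        (freqPairing (ν i) p)
    refine (h1.cexp.const_mul (κ i)).congr_deriv ?_
    simp only [dirDeriv]
    ring
  have hbound : ∀ (i : ι) (s : ℂ), s ∈ Metric.ball (0 : ℂ) r →
      ‖dirDeriv ν w κ i * Complex.exp (freqPairing (ν i) (p + s • w))‖ ≤
      ‖dirDeriv ν w κ i‖ * Real.exp (2 * Real.pi * (‖p‖ + r * ‖w‖) * ∑ j, |ν i j|) := by
    intro i s hs
    refine norm_term_le _ _ _ ((norm_add_le _ _).trans ?_)
    rw [norm_smul]
    have : ‖s‖ ≤ r := by simpa using (Metric.mem_ball.mp hs).le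
    gcongr
  exact hasDerivAt_tsum_of_isPreconnected
    ((h.dirDeriv w) (2 * Real.pi * (‖p‖ + r * ‖w‖))) Metric.isOpen_ball
    (convex_ball (0 : ℂ) r).isPreconnected hterm hbound ht
    (h.summable (p + t • w)) ht

end ExpSum

/-! ### Theta functions as rapidly decaying exponential series -/

section Theta

variable {g : ℕ}

/-- The quadratic part of the coefficients of the theta series. -/
noncomputable def thetaCoeff (τ : Matrix (Fin g) (Fin g) ℂ) (ν : Fin g → ℝ) : ℂ :=
  Complex.exp (2 * (Real.pi : ℂ) * Complex.I *
    (1 / 2 * ((fun i => (ν i : ℂ)) ⬝ᵥ (τ *ᵥ fun i => (ν i : ℂ)))))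

/-- The frequencies `m + ε` of the theta series. -/
def thetaFreq (ε : Fin g → ℝ) (m : Fin g → ℤ) : Fin g → ℝ := fun i => (m i : ℝ) + ε i

theorem thetaTerm_eq (τ : Matrix (Fin g) (Fin g) ℂ) (ε δ : Fin g → ℝ) (z : Fin g → ℂ)
    (m : Fin g → ℤ) :
    thetaTerm τ ε δ z m = thetaCoeff τ (thetaFreq ε m) *
      Complex.exp (freqPairing (thetaFreq ε m) (z + fun i => (δ i : ℂ))) := by
  rw [thetaCoeff, ← Complex.exp_add]
  simp [thetaTerm, thetaFreq, freqPairing, dotProduct, mul_add]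

theorem theta_eq_expSum (τ : Matrix (Fin g) (Fin g) ℂ) (ε δ : Fin g → ℝ) (z : Fin g → ℂ) :
    theta τ ε δ z = expSum (thetaFreq ε) (fun m => thetaCoeff τ (thetaFreq ε m))
      (z + fun i => (δ i : ℂ)) :=
  tsum_congr fun m => thetaTerm_eq τ ε δ z m

theorem norm_thetaCoeff (τ : Matrix (Fin g) (Fin g) ℂ) (ν : Fin g → ℝ) :
    ‖thetaCoeff τ ν‖ = Real.exp (-Real.pi * (ν ⬝ᵥ (τ.map Complex.im *ᵥ ν))) := by
  rw [thetaCoeff, Complex.norm_exp]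
  congr 1
  have : ((fun i => (ν i : ℂ)) ⬝ᵥ (τ *ᵥ fun i => (ν i : ℂ))).im =
      ν ⬝ᵥ (τ.map Complex.im *ᵥ ν) := by
    simp [dotProduct, Matrix.mulVec, Complex.im_sum]
  rw [← this]
  generalize ((fun i => (ν i : ℂ)) ⬝ᵥ (τ *ᵥ fun i => (ν i : ℂ))) = x
  have : 2 * (Real.pi : ℂ) * Complex.I * (1 / 2 * x) = Real.pi * (Complex.I * x) := by ring
  rw [this, Complex.re_ofReal_mul]
  simp

theorem rapidDecay_thetaCoeff {τ : Matrix (Fin g) (Fin g) ℂ} (hτ : (τ.map Complex.im).PosDef)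
    (ε : Fin g → ℝ) :
    RapidDecay (thetaFreq ε) (fun m => thetaCoeff τ (thetaFreq ε m)) := by
  obtain ⟨c, hc, hcoer⟩ := hτ.exists_coercive
  intro R
  set b : ℝ := Real.pi * c
  have hb : 0 < b := mul_pos Real.pi_pos hc
  have key : ∀ (m : Fin g → ℤ), ‖thetaCoeff τ (thetaFreq ε m)‖ *
      Real.exp (R * ∑ j, |thetaFreq ε m j|) ≤
      Real.exp (∑ j, ((R + 1) ^ 2 / (4 * b) + |ε j|)) * ∏ j, Real.exp (-|(m j : ℝ)|) := by
    intro m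
    rw [norm_thetaCoeff, ← Real.exp_add, ← Real.exp_sum, ← Real.exp_add]
    refine Real.exp_le_exp.mpr ?_
    have h1 := mul_le_mul_of_nonneg_left (hcoer (thetaFreq ε m)) Real.pi_pos.le
    rw [← mul_assoc, Finset.mul_sum] at h1
    rw [← Finset.sum_add_distrib, Finset.mul_sum]
    have h2 : ∑ j, (R * |thetaFreq ε m j| - b * thetaFreq ε m j ^ 2) ≤
        ∑ j, ((R + 1) ^ 2 / (4 * b) + |ε j| + -|(m j : ℝ)|) := by
      refine Finset.sum_le_sum fun j _ => ?_
      have h3 : |(m j : ℝ)| ≤ |thetaFreq ε m j| + |ε j| := by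
        have := abs_sub (thetaFreq ε m j) (ε j)
        simpa [thetaFreq] using this
      -- Completing the square. Using R + 1 instead of R leaves a spare factor exp(-|x|), which
      -- makes the sum over ℤ^g converge.
      have h4 : (R + 1) * |thetaFreq ε m j| - b * |thetaFreq ε m j| ^ 2 ≤ (R + 1) ^ 2 / (4 * b) := by
        rw [le_div_iff₀ (by positivity)]
        nlinarith [sq_nonneg (2 * b * |thetaFreq ε m j| - (R + 1))]
      rw [sq_abs] at h4
      linarith
    rw [Finset.sum_sub_distrib] at h2
    linarith
  exact Summable.of_nonneg_of_le (fun m => by positivity) key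
    ((summable_pi_prod summable_exp_neg_abs_int (fun _ => (Real.exp_pos _).le) g).mul_left _)

end Theta

/-! ### Joint holomorphy and the integral domain property -/

section ExpSum

variable {ι : Type*} {g : ℕ} {ν : ι → Fin g → ℝ} {κ : ι → ℂ}

/-- Differentiability jointly in all variables is needed because the cancellation arguments below
treat shifts as complex parameters. -/
theorem differentiable_expSum (h : RapidDecay ν κ) : Differentiable ℂ (expSum ν κ) := by
  intro z
  let Λ : (Fin g → ℝ) → ((Fin g → ℂ) →L[ℂ] ℂ) := fun μ =>
    LinearMap.toContinuousLinearMap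
      { toFun := freqPairing μ
        map_add' := freqPairing_add μ
        map_smul' := freqPairing_smul μ }
  have hΛ : ∀ μ, ‖Λ μ‖ ≤ 2 * Real.pi * ∑ j, |μ j| := fun μ =>
    ContinuousLinearMap.opNorm_le_bound _ (by positivity) fun w =>
      (norm_freqPairing_le μ w).trans (by linarith)
  obtain ⟨r, hr⟩ : ∃ r : ℝ, ‖z‖ < r := ⟨‖z‖ + 1, by linarith⟩
  have hz : z ∈ Metric.ball (0 : Fin g → ℂ) r := by simpa using hr
  have hterm : ∀ (i : ι) (w : Fin g → ℂ), w ∈ Metric.ball (0 : Fin g → ℂ) r → HasFDerivAt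
      (fun w => κ i * Complex.exp (freqPairing (ν i) w))
      (κ i • (Complex.exp (freqPairing (ν i) w) • Λ (ν i))) w := fun i w _ =>
    ((Λ (ν i)).hasFDerivAt.cexp).const_mul (κ i)
  have hbound : ∀ (i : ι) (w : Fin g → ℂ), w ∈ Metric.ball (0 : Fin g → ℂ) r →
      ‖κ i • (Complex.exp (freqPairing (ν i) w) • Λ (ν i))‖ ≤
      ‖κ i‖ * Real.exp ((2 * Real.pi * r + 2 * Real.pi) * ∑ j, |ν i j|) := by
    intro i w hw
    have h1 := norm_term_le (ν i) (κ i) w (by simpa using (Metric.mem_ball.mp hw).le : ‖w‖ ≤ r)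
    rw [smul_smul, norm_smul, add_mul, Real.exp_add, ← mul_assoc]
    gcongr
    exact (hΛ _).trans (by linarith [Real.add_one_le_exp (2 * Real.pi * ∑ j, |ν i j|)])
  exact (hasFDerivAt_tsum_of_isPreconnected (h (2 * Real.pi * r + 2 * Real.pi))
    Metric.isOpen_ball (convex_ball (0 : Fin g → ℂ) r).isPreconnected hterm hbound hz
    (h.summable z) hz).differentiableAt

end ExpSum

/-- Entire functions on a complex normed space form an integral domain. -/
theorem eq_zero_or_eq_zero_of_differentiable_mul {E : Type*} [NormedAddCommGroup E]
    [NormedSpace ℂ E] {f h : E → ℂ} (hf : Differentiable ℂ f) (hh : Differentiable ℂ h)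
    (hfh : ∀ x, f x * h x = 0) : (∀ x, f x = 0) ∨ ∀ x, h x = 0 := by
  by_contra! hcon
  obtain ⟨⟨x, hx⟩, ⟨y, hy⟩⟩ := hcon
  -- Restriction to the complex line from a point where f ≠ 0 to a point where h ≠ 0 reduces to one
  -- variable.
  have hl : Differentiable ℂ fun t : ℂ => x + t • (y - x) := by fun_prop
  have h1 : AnalyticOnNhd ℂ (fun t : ℂ => f (x + t • (y - x))) Set.univ :=
    (hf.comp hl).differentiableOn.analyticOnNhd isOpen_univ
  have h2 : AnalyticOnNhd ℂ (fun t : ℂ => h (x + t • (y - x))) Set.univ :=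
    (hh.comp hl).differentiableOn.analyticOnNhd isOpen_univ
  rcases h1.eq_zero_or_eq_zero_of_mul_eq_zero h2 (fun t _ => hfh _) isPreconnected_univ with h | h
  · exact hx (by simpa using h 0 (Set.mem_univ _))
  · exact hy (by simpa using h 1 (Set.mem_univ _))

/-! ### Non-vanishing and quasi-periodicity of theta -/

section Theta

variable {g : ℕ} {τ : Matrix (Fin g) (Fin g) ℂ}

theorem theta_lower (ε δ : Fin g → ℝ) (z : Fin g → ℂ) :
    theta τ ε δ z = theta τ ε 0 (z + fun i => (δ i : ℂ)) := by
  simp only [theta_eq_expSum, Pi.zero_apply, Complex.ofReal_zero]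
  congr 1
  ext i
  simp

theorem theta_zero_eq_expSum (ε : Fin g → ℝ) :
    theta τ ε 0 = expSum (thetaFreq ε) (fun m => thetaCoeff τ (thetaFreq ε m)) := by
  funext z
  rw [theta_eq_expSum]
  congr 1
  ext i
  simp

theorem summable_norm_thetaTerm (hτ : (τ.map Complex.im).PosDef) (ε : Fin g → ℝ)
    (z : Fin g → ℂ) : Summable fun m => ‖thetaTerm τ ε 0 z m‖ := by
  simp only [thetaTerm_eq]
  exact (rapidDecay_thetaCoeff hτ ε).summable_norm _

theorem posDef_natCast_smul (hτ : (τ.map Complex.im).PosDef) {N : ℕ} (hN : 0 < N) :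
    (((N : ℂ) • τ).map Complex.im).PosDef := by
  have : ((N : ℂ) • τ).map Complex.im = (N : ℝ) • τ.map Complex.im := by
    ext i j
    simp
  rw [this]
  exact hτ.smul (by exact_mod_cast hN)

/-- The theta function does not vanish identically. -/
theorem exists_theta_ne_zero (hτ : (τ.map Complex.im).PosDef) : ∃ z, theta τ 0 0 z ≠ 0 := by
  by_contra! hzero
  let _ : MeasureTheory.MeasureSpace UnitAddCircle := ⟨AddCircle.haarAddCircle⟩
  have _ : MeasureTheory.IsProbabilityMeasure
      (MeasureTheory.volume : MeasureTheory.Measure UnitAddCircle) :=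
    inferInstanceAs (MeasureTheory.IsProbabilityMeasure AddCircle.haarAddCircle)
  set c : (Fin g → ℤ) → ℂ := fun m => thetaCoeff τ (thetaFreq 0 m) with hc
  have hsum : Summable fun m => c m • UnitAddTorus.mFourier m := by
    refine Summable.of_norm ?_
    refine ((rapidDecay_thetaCoeff hτ 0).summable_norm 0).congr fun m => ?_
    simp [norm_smul, UnitAddTorus.mFourier_norm, freqPairing, hc]
  -- For real z the theta series is an absolutely convergent Fourier series on the torus.
  have hval : ∑' m, c m • UnitAddTorus.mFourier m = 0 := by
    ext x
    choose y hy using fun i => QuotientAddGroup.mk_surjective (x i)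
    have h1 := (ContinuousMap.evalCLM ℂ x).map_tsum hsum
    have h2 : ∀ m : Fin g → ℤ, (ContinuousMap.evalCLM ℂ x) (c m • UnitAddTorus.mFourier m) =
        c m * Complex.exp (freqPairing (thetaFreq 0 m) fun i => (y i : ℂ)) := by
      intro m
      have h3 : ∀ i, fourier (m i) (x i) =
          Complex.exp (2 * Real.pi * Complex.I * (m i * y i)) := by
        intro i
        rw [← hy i]
        refine (fourier_coe_apply (T := 1)).trans ?_
        congr 1
        push_cast
        ring
      simp only [ContinuousMap.evalCLM_apply, ContinuousMap.smul_apply, smul_eq_mul,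
        UnitAddTorus.mFourier, ContinuousMap.coe_mk, h3, ← Complex.exp_sum]
      simp [freqPairing, thetaFreq, Finset.mul_sum]
    simp only [h2] at h1
    have h4 := hzero fun i => (y i : ℂ)
    rw [theta_zero_eq_expSum] at h4
    exact h1.trans h4
  have h5 := (hval ▸ hsum.hasSum).mapL
    (ContinuousMap.toLp (E := ℂ) 2 (MeasureTheory.volume : MeasureTheory.Measure
      (UnitAddTorus (Fin g))) ℂ)
  -- Pairing with the constant character isolates the coefficient of m = 0, which is an exponential
  -- and so nonzero.
  have h6 := h5.mapL (innerSL ℂ (UnitAddTorus.mFourierLp 2 (0 : Fin g → ℤ)))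
  have h7 : ∀ m : Fin g → ℤ, m ≠ 0 → (innerSL ℂ (UnitAddTorus.mFourierLp 2 (0 : Fin g → ℤ)))
      ((ContinuousMap.toLp (E := ℂ) 2 (MeasureTheory.volume : MeasureTheory.Measure
      (UnitAddTorus (Fin g))) ℂ) (c m • UnitAddTorus.mFourier m)) = 0 := by
    intro m hm
    rw [map_smul, map_smul]
    have := UnitAddTorus.orthonormal_mFourier (d := Fin g) |>.2 hm.symm
    simp only [innerSL_apply_apply]
    rw [show ContinuousMap.toLp (E := ℂ) 2 _ ℂ (UnitAddTorus.mFourier m) =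
      UnitAddTorus.mFourierLp 2 m from rfl, this, smul_zero]
  have h8 := h6.unique (hasSum_single 0 h7)
  rw [map_zero, map_zero, map_smul, map_smul, show ContinuousMap.toLp (E := ℂ) 2 _ ℂ
      (UnitAddTorus.mFourier (0 : Fin g → ℤ)) = UnitAddTorus.mFourierLp 2 0 from rfl,
    innerSL_apply_apply, inner_self_eq_norm_sq_to_K,
    UnitAddTorus.orthonormal_mFourier.1] at h8
  simp only [hc, thetaCoeff, RCLike.ofReal_one, one_pow, smul_eq_mul, mul_one] at h8
  exact Complex.exp_ne_zero _ h8.symm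

/-- A shift of the upper characteristic is a translation by the corresponding multiple of `τ`. -/
theorem theta_add_upper (hτ : τ.IsSymm) (ε s : Fin g → ℝ) (z : Fin g → ℂ) :
    theta τ (ε + s) 0 z = Complex.exp (2 * (Real.pi : ℂ) * Complex.I *
      (1 / 2 * ((fun i => (s i : ℂ)) ⬝ᵥ (τ *ᵥ fun i => (s i : ℂ))) +
        (fun i => (s i : ℂ)) ⬝ᵥ z)) * theta τ ε 0 (z + τ *ᵥ fun i => (s i : ℂ)) := by
  unfold theta
  rw [← tsum_mul_left]
  refine tsum_congr fun m => ?_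
  simp only [thetaTerm]
  rw [← Complex.exp_add]
  congr 1
  rw [← mul_add]
  congr 1
  set S : Fin g → ℂ := fun i => (s i : ℂ)
  set V : Fin g → ℂ := fun i => (m i : ℂ) + (ε i : ℂ) with hV
  have h1 : (fun i => (m i : ℂ) + (((ε + s) i : ℝ) : ℂ)) = V + S := by
    ext i
    simp [hV, S]
    ring
  have h2 : S ⬝ᵥ (τ *ᵥ V) = V ⬝ᵥ (τ *ᵥ S) := by
    rw [Matrix.dotProduct_mulVec, ← Matrix.mulVec_transpose, hτ.eq, dotProduct_comm]
  have h3 : ∀ w : Fin g → ℂ, (fun i => w i + (((0 : Fin g → ℝ) i : ℝ) : ℂ)) = w := by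
    intro w; ext i; simp
  rw [h1, h3, h3]
  simp only [Matrix.mulVec_add, dotProduct_add, add_dotProduct, h2]
  ring

theorem theta_add_intVec (ε : Fin g → ℝ) (k : Fin g → ℤ) (z : Fin g → ℂ) :
    theta τ ε 0 (z + fun i => (k i : ℂ)) =
      Complex.exp (2 * (Real.pi : ℂ) * Complex.I * ∑ i, (ε i : ℂ) * k i) * theta τ ε 0 z := by
  simp only [theta_zero_eq_expSum, expSum]
  rw [← tsum_mul_left]
  refine tsum_congr fun m => ?_
  rw [freqPairing_add, Complex.exp_add]
  have : Complex.exp (freqPairing (thetaFreq ε m) fun i => (k i : ℂ)) =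
      Complex.exp (2 * (Real.pi : ℂ) * Complex.I * ∑ i, (ε i : ℂ) * k i) := by
    have h : freqPairing (thetaFreq ε m) (fun i => (k i : ℂ)) =
        2 * (Real.pi : ℂ) * Complex.I * (∑ i, (ε i : ℂ) * k i) +
        ((∑ i, m i * k i : ℤ) : ℂ) * (2 * (Real.pi : ℂ) * Complex.I) := by
      simp only [freqPairing, thetaFreq]
      push_cast
      simp only [add_mul, Finset.sum_add_distrib]
      ring
    rw [h, Complex.exp_add, Complex.exp_int_mul_two_pi_mul_I, mul_one]
  rw [this]
  ring

end Theta

/-! ### Multiplication formula -/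

section Multiplication

variable {g : ℕ}

/-- Euclidean division by `N + 1` identifies `(b, l, j)` with `(b + j - N l, b + l)`. -/
def thetaIndexEquiv (g N : ℕ) :
    (Fin g → Fin (N + 1)) × ((Fin g → ℤ) × (Fin g → ℤ)) ≃ (Fin g → ℤ) × (Fin g → ℤ) where
  toFun p := (fun i => p.2.1 i + (p.1 i : ℕ) - N * p.2.2 i, fun i => p.2.1 i + p.2.2 i)
  -- With (m, m') the pair on the right, m + N m' = j + (N + 1) b: so j and b are remainder and
  -- quotient, and l = m' - b.
  invFun q := (fun i => ⟨((q.1 i + N * q.2 i) % ((N + 1 : ℕ) : ℤ)).toNat, by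
      have h1 := Int.emod_nonneg (q.1 i + N * q.2 i) (by positivity : ((N + 1 : ℕ) : ℤ) ≠ 0)
      have h2 := Int.emod_lt_of_pos (q.1 i + N * q.2 i) (by positivity : 0 < ((N + 1 : ℕ) : ℤ))
      omega⟩,
    fun i => (q.1 i + N * q.2 i) / ((N + 1 : ℕ) : ℤ),
    fun i => q.2 i - (q.1 i + N * q.2 i) / ((N + 1 : ℕ) : ℤ))
  left_inv := by
    rintro ⟨j, b, l⟩
    have h : ∀ i, b i + ((j i : ℕ) : ℤ) - N * l i + N * (b i + l i) =
        ((j i : ℕ) : ℤ) + ((N + 1 : ℕ) : ℤ) * b i := fun i => by push_cast; ring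
    have hj : ∀ i, ((j i : ℕ) : ℤ) < ((N + 1 : ℕ) : ℤ) := fun i => by exact_mod_cast (j i).2
    have hdiv : ∀ i, (((j i : ℕ) : ℤ) + ((N + 1 : ℕ) : ℤ) * b i) / ((N + 1 : ℕ) : ℤ) = b i :=
      fun i => by
        rw [Int.add_mul_ediv_left _ _ (by positivity), Int.ediv_eq_zero_of_lt (by positivity) (hj i),
          zero_add]
    have hmod : ∀ i, (((j i : ℕ) : ℤ) + ((N + 1 : ℕ) : ℤ) * b i) % ((N + 1 : ℕ) : ℤ) = (j i : ℕ) :=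
      fun i => by
        rw [Int.add_mul_emod_self_left, Int.emod_eq_of_lt (by positivity) (hj i)]
    refine Prod.ext (funext fun i => Fin.ext ?_) (Prod.ext (funext fun i => ?_) (funext fun i => ?_))
    · simp only [h, hmod]
      simp
    · simp only [h, hdiv]
    · simp only [h, hdiv]
      ring
  right_inv := by
    rintro ⟨m, m'⟩
    have h1 : ∀ i, 0 ≤ (m i + N * m' i) % ((N + 1 : ℕ) : ℤ) := fun i =>
      Int.emod_nonneg _ (by positivity)
    have h2 := fun i => Int.emod_add_mul_ediv (m i + N * m' i) ((N + 1 : ℕ) : ℤ)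
    refine Prod.ext (funext fun i => ?_) (funext fun i => ?_)
    · simp only [Int.toNat_of_nonneg (h1 i)]
      have := h2 i
      push_cast at this ⊢
      linarith
    · simp

/-- The two summation vectors are β - Nρ and β + ρ. The weights 1 and N make the cross terms cancel,
leaving the form (N + 1) on β and N(N + 1) on ρ. -/
theorem thetaTerm_mul_thetaTerm (T : Matrix (Fin g) (Fin g) ℂ) (N : ℕ) (ε ε' : Fin g → ℝ)
    (x y : Fin g → ℂ) (j : Fin g → Fin (N + 1)) (b l : Fin g → ℤ) :
    thetaTerm T ε 0 x (fun i => b i + (j i : ℕ) - N * l i) *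
      thetaTerm ((N : ℂ) • T) ε' 0 y (fun i => b i + l i) =
    thetaTerm (((N + 1 : ℕ) : ℂ) • T) (fun i => (ε i + N * ε' i + (j i : ℕ)) / (N + 1)) 0 (x + y) b *
      thetaTerm (((N * (N + 1) : ℕ) : ℂ) • T) (fun i => (ε' i - ε i - (j i : ℕ)) / (N + 1)) 0
        (y - (N : ℂ) • x) l := by
  simp only [thetaTerm]
  rw [← Complex.exp_add, ← Complex.exp_add]
  congr 1
  rw [← mul_add, ← mul_add]
  congr 1
  have hN : (N : ℂ) + 1 ≠ 0 := by exact_mod_cast Nat.succ_ne_zero N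
  have h3 : ∀ w : Fin g → ℂ, (fun i => w i + (((0 : Fin g → ℝ) i : ℝ) : ℂ)) = w := by
    intro w; ext i; simp
  set β : Fin g → ℂ := fun i => (b i : ℂ) + (((ε i + N * ε' i + (j i : ℕ)) / (N + 1) : ℝ) : ℂ)
    with hβ
  set ρ : Fin g → ℂ := fun i => (l i : ℂ) + (((ε' i - ε i - (j i : ℕ)) / (N + 1) : ℝ) : ℂ) with hρ
  have h1 : (fun i => ((b i + (j i : ℕ) - N * l i : ℤ) : ℂ) + (ε i : ℂ)) = β - (N : ℂ) • ρ := by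
    ext i
    simp only [hβ, hρ, Pi.sub_apply, Pi.smul_apply, smul_eq_mul]
    push_cast
    field_simp
    ring
  have h2 : (fun i => ((b i + l i : ℤ) : ℂ) + (ε' i : ℂ)) = β + ρ := by
    ext i
    simp only [hβ, hρ, Pi.add_apply]
    push_cast
    field_simp
    ring
  rw [h1, h2, h3, h3, h3, h3]
  simp only [Matrix.mulVec_add, Matrix.mulVec_sub, Matrix.mulVec_smul, Matrix.smul_mulVec,
    dotProduct_add, dotProduct_sub, add_dotProduct, sub_dotProduct, dotProduct_smul,
    smul_dotProduct, smul_eq_mul]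
  push_cast
  ring

/-- The multiplication formula for theta functions. -/
theorem theta_mul_theta {T : Matrix (Fin g) (Fin g) ℂ} (hT : (T.map Complex.im).PosDef)
    {N : ℕ} (hN : 0 < N) (ε ε' : Fin g → ℝ) (x y : Fin g → ℂ) :
    theta T ε 0 x * theta ((N : ℂ) • T) ε' 0 y = ∑ j : Fin g → Fin (N + 1),
      theta (((N + 1 : ℕ) : ℂ) • T) (fun i => (ε i + N * ε' i + (j i : ℕ)) / (N + 1)) 0 (x + y) *
      theta (((N * (N + 1) : ℕ) : ℂ) • T) (fun i => (ε' i - ε i - (j i : ℕ)) / (N + 1)) 0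
        (y - (N : ℂ) • x) := by
  have hs1 := summable_norm_thetaTerm hT ε x
  have hs2 := summable_norm_thetaTerm (posDef_natCast_smul hT hN) ε' y
  have hs := summable_mul_of_summable_norm hs1 hs2
  unfold theta
  rw [tsum_mul_tsum_of_summable_norm hs1 hs2, ← (thetaIndexEquiv g N).tsum_eq]
  have hs' := (thetaIndexEquiv g N).summable_iff.mpr hs
  refine (Summable.tsum_prod hs').trans ?_
  rw [tsum_fintype]
  refine Finset.sum_congr rfl fun j _ => ?_
  rw [tsum_mul_tsum_of_summable_norm
    (summable_norm_thetaTerm (posDef_natCast_smul hT (Nat.succ_pos N)) _ _)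
    (summable_norm_thetaTerm (posDef_natCast_smul hT (Nat.mul_pos hN (Nat.succ_pos N))) _ _)]
  exact tsum_congr fun p => thetaTerm_mul_thetaTerm T N ε ε' x y j p.1 p.2

end Multiplication

/-! ### Quotients of entire functions with translation-invariant increments -/

/-- An entire solution of `Z'X = ZX'` with `Z(0) = 0` and `X(0) ≠ 0` vanishes. -/
theorem eq_zero_of_wronskian_eq_zero {X Z : ℂ → ℂ} (hX : Differentiable ℂ X)
    (hZ : Differentiable ℂ Z) (hX0 : X 0 ≠ 0) (hZ0 : Z 0 = 0)
    (h : ∀ s, deriv Z s * X s = Z s * deriv X s) (s : ℂ) : Z s = 0 := by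
  obtain ⟨r, hr, hball⟩ := Metric.eventually_nhds_iff_ball.mp
    (hX.continuous.continuousAt.eventually_ne hX0)
  -- Near 0 the quotient Z/X has derivative zero; the identity theorem then extends Z = 0 from this
  -- ball to ℂ.
  have hquot : ∀ t ∈ Metric.ball (0 : ℂ) r, Z t / X t = 0 := by
    intro t ht
    have hd : ∀ u ∈ Metric.ball (0 : ℂ) r, HasDerivAt (fun u => Z u / X u) 0 u := by
      intro u hu
      refine ((hZ u).hasDerivAt.div (hX u).hasDerivAt (hball u hu)).congr_deriv ?_
      rw [h u, sub_self, zero_div]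
    have hconst := Metric.isOpen_ball.is_const_of_deriv_eq_zero
      (convex_ball (0 : ℂ) r).isPreconnected
      (fun u hu => (hd u hu).differentiableAt.differentiableWithinAt)
      (fun u hu => (hd u hu).deriv) ht (Metric.mem_ball_self hr)
    simpa [hZ0] using hconst
  have hZloc : Z =ᶠ[nhds 0] fun _ => 0 := by
    filter_upwards [Metric.ball_mem_nhds (0 : ℂ) hr] with t ht
    exact (div_eq_zero_iff.mp (hquot t ht)).resolve_right (hball t ht)
  exact congrFun ((hZ.differentiableOn.analyticOnNhd isOpen_univ).eq_of_eventuallyEq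
    ((differentiable_const 0).differentiableOn.analyticOnNhd isOpen_univ) hZloc) s

/-- If the increments of the periodic function `Y/X` do not depend on the base point, then `Y/X`
is constant. -/
theorem mul_eq_mul_of_increment_eq {X Y : ℂ → ℂ} (hX : Differentiable ℂ X)
    (hY : Differentiable ℂ Y) (hX0 : X 0 ≠ 0) (hX1 : X 1 = X 0) (hY1 : Y 1 = Y 0)
    (h : ∀ s t, (Y (s + t) * X s - Y s * X (s + t)) * (X 0 * X t) =
      (Y t * X 0 - Y 0 * X t) * (X s * X (s + t))) (s : ℂ) :
    Y s * X 0 = Y 0 * X s := by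
  set k : ℂ := deriv Y 0 * X 0 - Y 0 * deriv X 0 with hk
  -- The t-derivative of the hypothesis at 0 says that (Y/X)' is the constant k/X(0)², with
  -- denominators cleared.
  have hode : ∀ s, (deriv Y s * X s - Y s * deriv X s) * X 0 ^ 2 = k * X s ^ 2 := by
    intro s
    have hXs : HasDerivAt (fun t => X (s + t)) (deriv X s) 0 := by
      have := (hX (s + 0)).hasDerivAt.comp_const_add s 0
      simpa using this
    have hYs : HasDerivAt (fun t => Y (s + t)) (deriv Y s) 0 := by
      have := (hY (s + 0)).hasDerivAt.comp_const_add s 0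
      simpa using this
    have hl := ((hYs.mul_const (X s)).sub (hXs.const_mul (Y s))).mul
      ((hX 0).hasDerivAt.const_mul (X 0))
    have hr := (((hY 0).hasDerivAt.mul_const (X 0)).sub ((hX 0).hasDerivAt.const_mul (Y 0))).mul
      (hXs.const_mul (X s))
    have heq := hl.unique (hr.congr_of_eventuallyEq (Filter.Eventually.of_forall fun t => h s t))
    simp only [Pi.sub_apply, add_zero] at heq
    rw [hk]
    linear_combination heq
  -- So Y/X is affine in s; periodicity then excludes a nonzero slope.
  have hZ : ∀ s, Y s * X 0 ^ 2 - (Y 0 * X 0 + k * s) * X s = 0 := by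
    have hd : ∀ s, HasDerivAt (fun s => Y s * X 0 ^ 2 - (Y 0 * X 0 + k * s) * X s)
        (deriv Y s * X 0 ^ 2 - (k * X s + (Y 0 * X 0 + k * s) * deriv X s)) s := by
      intro s
      have h1 : HasDerivAt (fun s : ℂ => Y 0 * X 0 + k * s) k s := by
        simpa using ((hasDerivAt_id s).const_mul k).const_add (Y 0 * X 0)
      exact ((hY s).hasDerivAt.mul_const _).sub (h1.mul (hX s).hasDerivAt)
    refine eq_zero_of_wronskian_eq_zero hX (fun s => (hd s).differentiableAt) hX0 (by ring) ?_
    intro s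
    rw [(hd s).deriv]
    linear_combination hode s
  have hk0 : k = 0 := by
    have h1 := hZ 1
    rw [hX1, hY1] at h1
    have : k * X 0 = 0 := by linear_combination -h1
    exact (mul_eq_zero.mp this).resolve_right hX0
  have h2 := hZ s
  rw [hk0] at h2
  have : X 0 * (Y s * X 0 - Y 0 * X s) = 0 := by linear_combination h2
  exact sub_eq_zero.mp ((mul_eq_zero.mp this).resolve_left hX0)

/-! ### From second order equations to a constant logarithmic derivative -/

section Rigidity

variable {g : ℕ} {F G : (Fin g → ℂ) → ℂ}

/-- If the increments of `G/F` do not depend on the base point, for `F` and `G` periodic with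
respect to `ℤ^g`, then `G/F` is constant. -/
theorem mul_eq_mul_of_increment_eq_pi (hF : Differentiable ℂ F) (hG : Differentiable ℂ G)
    (hFper : ∀ z j, F (z + Pi.single j 1) = F z) (hGper : ∀ z j, G (z + Pi.single j 1) = G z)
    (hne : ∃ z, F z ≠ 0)
    (h : ∀ q q' p, (G (q + p) * F q - G q * F (q + p)) * (F q' * F (q' + p)) =
      (G (q' + p) * F q' - G q' * F (q' + p)) * (F q * F (q + p))) (q p : Fin g → ℂ) :
    G (q + p) * F q - G q * F (q + p) = 0 := by
  obtain ⟨q₀, hq₀⟩ := hne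
  have haxis : ∀ (j : Fin g) (s : ℂ) (q : Fin g → ℂ),
      G (q + s • Pi.single j 1) * F q - G q * F (q + s • Pi.single j 1) = 0 := by
    intro j s q
    set e : Fin g → ℂ := Pi.single j 1
    have hbase : ∀ s : ℂ, G (q₀ + s • e) * F q₀ = G q₀ * F (q₀ + s • e) := by
      have := mul_eq_mul_of_increment_eq (X := fun s : ℂ => F (q₀ + s • e))
        (Y := fun s : ℂ => G (q₀ + s • e)) (by fun_prop) (by fun_prop) (by simpa using hq₀)
        (by simpa using hFper q₀ j) (by simpa using hGper q₀ j) (fun s t => by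
          have := h (q₀ + s • e) q₀ (t • e)
          simpa [add_smul, add_assoc] using this)
      simpa using this
    -- The increment vanishes at the base point q₀, hence at every base point after cancelling F q₀
    -- * F (q₀ + s • e), which is not identically zero.
    have hmul : ∀ s : ℂ, (G (q + s • e) * F q - G q * F (q + s • e)) *
        (F q₀ * F (q₀ + s • e)) = 0 := by
      intro s
      rw [h q q₀ (s • e), hbase s]
      ring
    rcases eq_zero_or_eq_zero_of_differentiable_mul (by fun_prop) (by fun_prop) hmul with h1 | h1
    · exact h1 s
    · exact absurd (h1 0) (by simpa using hq₀)
  -- The increments p that work for all base points are closed under addition, so the coordinate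
  -- axes suffice.
  have hadd : ∀ p p' : Fin g → ℂ, (∀ q, G (q + p) * F q - G q * F (q + p) = 0) →
      (∀ q, G (q + p') * F q - G q * F (q + p') = 0) →
      ∀ q, G (q + (p + p')) * F q - G q * F (q + (p + p')) = 0 := by
    intro p p' hp hp'
    have hmul : ∀ q, F (q + p) * (G (q + (p + p')) * F q - G q * F (q + (p + p'))) = 0 := by
      intro q
      have h1 := hp q
      have h2 := hp' (q + p)
      rw [← add_assoc]
      linear_combination F q * h2 + F (q + p + p') * h1
    rcases eq_zero_or_eq_zero_of_differentiable_mul (by fun_prop) (by fun_prop) hmul with h1 | h1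
    · exact absurd (h1 (q₀ - p)) (by simpa using hq₀)
    · exact h1
  have hall : ∀ q, G (q + p) * F q - G q * F (q + p) = 0 := by
    have hp : p = ∑ j, p j • (Pi.single j 1 : Fin g → ℂ) := by
      ext i
      simp [Finset.sum_apply, Pi.single_apply]
    rw [hp]
    refine Finset.sum_induction _
      (fun p => ∀ q, G (q + p) * F q - G q * F (q + p) = 0) hadd ?_ ?_
    · intro q
      simp
    · intro j _ q
      exact haxis j (p j) q
  exact hall q

/-- If all `P = A B` satisfy a differential equation of order two at a point, then the
Wronskians of the `A`s or those of the `B`s vanish there. -/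
theorem wronskian_mul_wronskian_eq_zero {A A' B B' : ℂ → ℂ} (hA : Differentiable ℂ A)
    (hA' : Differentiable ℂ A') (hB : Differentiable ℂ B) (hB' : Differentiable ℂ B') {μ c : ℂ}
    (h : ∀ P ∈ ({A, A'} : Set (ℂ → ℂ)), ∀ Q ∈ ({B, B'} : Set (ℂ → ℂ)),
      deriv (deriv fun t => P t * Q t) 0 + μ * deriv (fun t => P t * Q t) 0 + c * (P 0 * Q 0) = 0) :
    (deriv A 0 * A' 0 - A 0 * deriv A' 0) * (deriv B 0 * B' 0 - B 0 * deriv B' 0) = 0 := by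
  have key : ∀ P Q : ℂ → ℂ, Differentiable ℂ P → Differentiable ℂ Q →
      deriv (deriv fun t => P t * Q t) 0 + μ * deriv (fun t => P t * Q t) 0 + c * (P 0 * Q 0) =
      deriv (deriv P) 0 * Q 0 + 2 * (deriv P 0 * deriv Q 0) + P 0 * deriv (deriv Q) 0 +
        μ * (deriv P 0 * Q 0 + P 0 * deriv Q 0) + c * (P 0 * Q 0) := by
    intro P Q hP hQ
    have h1 : deriv (fun t => P t * Q t) = fun t => deriv P t * Q t + P t * deriv Q t :=
      funext fun t => deriv_fun_mul (hP t) (hQ t)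
    have hP' : Differentiable ℂ (deriv P) := hP.deriv
    have hQ' : Differentiable ℂ (deriv Q) := hQ.deriv
    have h2 := ((hP' 0).hasDerivAt.fun_mul (hQ 0).hasDerivAt).fun_add
      ((hP 0).hasDerivAt.fun_mul (hQ' 0).hasDerivAt)
    rw [h1, h2.deriv]
    ring
  have h11 := h A (by simp) B (by simp)
  have h12 := h A (by simp) B' (by simp)
  have h21 := h A' (by simp) B (by simp)
  have h22 := h A' (by simp) B' (by simp)
  rw [key _ _ ‹_› ‹_›] at h11 h12 h21 h22
  -- Divided by PQ, the equation is a sum of terms depending on P alone or on Q alone, plus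
  -- 2(P'/P)(Q'/Q). The mixed second difference over the four pairs keeps only this last term.
  linear_combination (1 / 2) * (A' 0 * B' 0) * h11 - (1 / 2) * (A' 0 * B 0) * h12 -
    (1 / 2) * (A 0 * B' 0) * h21 + (1 / 2) * (A 0 * B 0) * h22

/-- The differential equations for the products of translates of `F` imply that the increments of
the logarithmic derivative `G/F` do not depend on the base point. -/
theorem increment_eq_of_jet_eq_zero (hF : Differentiable ℂ F) (hG : Differentiable ℂ G)
    {w : Fin g → ℂ} (hFG : ∀ z t, HasDerivAt (fun t : ℂ => F (t • w + z)) (G (t • w + z)) t)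
    (hne : ∃ z, F z ≠ 0) (k : ℕ) (s : Fin g → ℂ) {μ c : ℂ}
    (h : ∀ q₁ q₂ q₃ q₄ r : Fin g → ℂ, q₁ + (q₂ + (q₃ + (q₄ + k • r))) = s →
      deriv (deriv fun t : ℂ => (F (t • w + q₁) * F (t • w + q₂)) *
        (F (t • w + q₃) * (F (t • w + q₄) * F (t • w + r) ^ k))) 0 +
      μ * deriv (fun t : ℂ => (F (t • w + q₁) * F (t • w + q₂)) *
        (F (t • w + q₃) * (F (t • w + q₄) * F (t • w + r) ^ k))) 0 +
      c * ((F q₁ * F q₂) * (F q₃ * (F q₄ * F r ^ k))) = 0) (q q' p : Fin g → ℂ) :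
    (G (q + p) * F q - G q * F (q + p)) * (F q' * F (q' + p)) =
      (G (q' + p) * F q' - G q' * F (q' + p)) * (F q * F (q + p)) := by
  obtain ⟨r₀, hr₀⟩ := hne
  -- The value at t = 0 of the Wronskian of F(tw+q+p)F(tw+q') and F(tw+q)F(tw+q'+p), two products
  -- with the same sum of shifts.
  let W : (Fin g → ℂ) → (Fin g → ℂ) → (Fin g → ℂ) → ℂ := fun q q' p =>
    (G (q + p) * F q' + F (q + p) * G q') * (F q * F (q' + p)) -
      (F (q + p) * F q') * (G q * F (q' + p) + F q * G (q' + p))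
  have hprod : ∀ q q' p r p', W q q' p *
      W r (s - k • r₀ - q - q' - p - r - p') p' = 0 := by
    intro q q' p r p'
    -- The sum condition determines r'; the remaining k factors sit at r₀, where F does not vanish,
    -- so they can be cancelled.
    set r' := s - k • r₀ - q - q' - p - r - p' with hr'
    have hd : ∀ z, Differentiable ℂ fun t : ℂ => F (t • w + z) := fun z => by fun_prop
    have hdA : ∀ a b, HasDerivAt (fun t : ℂ => F (t • w + a) * F (t • w + b))
        (G a * F b + F a * G b) 0 := fun a b => by
      simpa using (hFG a 0).fun_mul (hFG b 0)
    have hdB : ∀ a b, HasDerivAt (fun t : ℂ => F (t • w + a) * (F (t • w + b) * F (t • w + r₀) ^ k))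
        ((G a * F b + F a * G b) * F r₀ ^ k + F a * F b *
          deriv (fun t : ℂ => F (t • w + r₀) ^ k) 0) 0 := fun a b => by
      have h1 : HasDerivAt (fun t : ℂ => F (t • w + r₀) ^ k)
          (deriv (fun t : ℂ => F (t • w + r₀) ^ k) 0) 0 :=
        (((hd r₀).pow k) 0).hasDerivAt
      have h2 := (hdA a b).mul h1
      simp only [zero_smul, zero_add] at h2
      exact h2.congr_of_eventuallyEq (Filter.Eventually.of_forall fun t => by
        simp only [Pi.mul_apply]; ring)
    have hwr := wronskian_mul_wronskian_eq_zero (μ := μ) (c := c)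
      (A := fun t : ℂ => F (t • w + (q + p)) * F (t • w + q'))
      (A' := fun t : ℂ => F (t • w + q) * F (t • w + (q' + p)))
      (B := fun t : ℂ => F (t • w + (r + p')) * (F (t • w + r') * F (t • w + r₀) ^ k))
      (B' := fun t : ℂ => F (t • w + r) * (F (t • w + (r' + p')) * F (t • w + r₀) ^ k))
      (by fun_prop) (by fun_prop) (by fun_prop) (by fun_prop) (by
        rintro P (rfl | rfl) Q (rfl | rfl)
        · simpa using h (q + p) q' (r + p') r' r₀ (by rw [hr']; abel)
        · simpa using h (q + p) q' r (r' + p') r₀ (by rw [hr']; abel)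
        · simpa using h q (q' + p) (r + p') r' r₀ (by rw [hr']; abel)
        · simpa using h q (q' + p) r (r' + p') r₀ (by rw [hr']; abel))
    rw [(hdA _ _).deriv, (hdA _ _).deriv, (hdB _ _).deriv, (hdB _ _).deriv] at hwr
    simp only [zero_smul, zero_add] at hwr
    have hE : (F r₀ ^ k) ^ 2 * (W q q' p * W r r' p') = 0 := by
      simp only [W]
      linear_combination hwr
    exact (mul_eq_zero.mp hE).resolve_left (by positivity)
  have hW : ∀ q q' p, W q q' p = 0 := by
    let V := Fin g → ℂ
    rcases eq_zero_or_eq_zero_of_differentiable_mul (E := V × V × V × V × V)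
      (f := fun x => W x.1 x.2.1 x.2.2.1)
      (h := fun x => W x.2.2.2.1
        (s - k • r₀ - x.1 - x.2.1 - x.2.2.1 - x.2.2.2.1 - x.2.2.2.2) x.2.2.2.2)
      (by simp only [W]; fun_prop) (by simp only [W]; fun_prop)
      (fun x => hprod _ _ _ _ _) with h1 | h1
    · intro q q' p
      exact h1 (q, q', p, 0, 0)
    · intro q q' p
      -- The first argument is chosen so that the dependent shift becomes q'.
      have := h1 (s - k • r₀ - q - q' - p, 0, 0, q, p)
      have hq : s - k • r₀ - (s - k • r₀ - q - q' - p) - 0 - 0 - q - p = q' := by abel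
      simpa only [hq] using this
  have := hW q q' p
  simp only [W] at this
  linear_combination this

end Rigidity

/-! ### Derivatives of theta and non-constancy of its logarithmic derivative -/

section ThetaDeriv

variable {g : ℕ} {τ : Matrix (Fin g) (Fin g) ℂ}

/-- The directional derivative of the theta function, as an exponential series. -/
noncomputable def thetaDir (τ : Matrix (Fin g) (Fin g) ℂ) (ε : Fin g → ℝ) (v z : Fin g → ℂ) : ℂ :=
  expSum (thetaFreq ε) (dirDeriv (thetaFreq ε) v fun m => thetaCoeff τ (thetaFreq ε m)) z

/-- The second directional derivative of the theta function, as an exponential series. -/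
noncomputable def thetaDir₂ (τ : Matrix (Fin g) (Fin g) ℂ) (ε : Fin g → ℝ) (v w z : Fin g → ℂ) :
    ℂ :=
  expSum (thetaFreq ε)
    (dirDeriv (thetaFreq ε) v (dirDeriv (thetaFreq ε) w fun m => thetaCoeff τ (thetaFreq ε m))) z

theorem differentiable_theta (hτ : (τ.map Complex.im).PosDef) (ε : Fin g → ℝ) :
    Differentiable ℂ (theta τ ε 0) := by
  rw [theta_zero_eq_expSum]
  exact differentiable_expSum (rapidDecay_thetaCoeff hτ ε)

theorem differentiable_thetaDir (hτ : (τ.map Complex.im).PosDef) (ε : Fin g → ℝ)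
    (v : Fin g → ℂ) : Differentiable ℂ (thetaDir τ ε v) :=
  differentiable_expSum ((rapidDecay_thetaCoeff hτ ε).dirDeriv v)

theorem hasDerivAt_theta (hτ : (τ.map Complex.im).PosDef) (ε : Fin g → ℝ) (p v : Fin g → ℂ)
    (t : ℂ) : HasDerivAt (fun t : ℂ => theta τ ε 0 (p + t • v)) (thetaDir τ ε v (p + t • v)) t := by
  rw [theta_zero_eq_expSum]
  exact hasDerivAt_expSum (rapidDecay_thetaCoeff hτ ε) p v t

theorem hasDerivAt_thetaDir (hτ : (τ.map Complex.im).PosDef) (ε : Fin g → ℝ) (p v w : Fin g → ℂ)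
    (t : ℂ) : HasDerivAt (fun t : ℂ => thetaDir τ ε v (p + t • w))
      (thetaDir₂ τ ε w v (p + t • w)) t :=
  hasDerivAt_expSum ((rapidDecay_thetaCoeff hτ ε).dirDeriv v) p w t

theorem thetaDir_add (hτ : (τ.map Complex.im).PosDef) (ε : Fin g → ℝ) (v w z : Fin g → ℂ) :
    thetaDir τ ε (v + w) z = thetaDir τ ε v z + thetaDir τ ε w z := by
  have h := rapidDecay_thetaCoeff hτ ε
  rw [thetaDir, dirDeriv_add, expSum_add (h.dirDeriv v) (h.dirDeriv w)]
  rfl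

theorem thetaDir_smul (ε : Fin g → ℝ) (c : ℂ) (v z : Fin g → ℂ) :
    thetaDir τ ε (c • v) z = c * thetaDir τ ε v z := by
  rw [thetaDir, dirDeriv_smul, expSum_smul]
  rfl

/-- The second derivative is a quadratic form in the direction. -/
theorem thetaDir₂_smul_add_smul (hτ : (τ.map Complex.im).PosDef) (ε : Fin g → ℝ) (x y : ℂ)
    (v w z : Fin g → ℂ) : thetaDir₂ τ ε (x • v + y • w) (x • v + y • w) z =
      x ^ 2 * thetaDir₂ τ ε v v z + x * y * (2 * thetaDir₂ τ ε v w z) +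
        y ^ 2 * thetaDir₂ τ ε w w z := by
  have h := rapidDecay_thetaCoeff hτ ε
  have hadd : ∀ a b c, thetaDir₂ τ ε (a + b) c z = thetaDir₂ τ ε a c z + thetaDir₂ τ ε b c z := by
    intro a b c
    rw [thetaDir₂, dirDeriv_add, expSum_add ((h.dirDeriv c).dirDeriv a) ((h.dirDeriv c).dirDeriv b)]
    rfl
  have hsmul : ∀ (r : ℂ) a c, thetaDir₂ τ ε (r • a) c z = r * thetaDir₂ τ ε a c z := by
    intro r a c
    rw [thetaDir₂, dirDeriv_smul, expSum_smul]
    rfl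
  have hcomm : ∀ a b, thetaDir₂ τ ε a b z = thetaDir₂ τ ε b a z := by
    intro a b
    rw [thetaDir₂, dirDeriv_comm]
    rfl
  rw [hadd, hsmul, hsmul, hcomm v, hcomm w, hadd, hadd, hsmul, hsmul, hsmul, hsmul, hcomm w v]
  ring

theorem theta_zero_add_single (z : Fin g → ℂ) (j : Fin g) :
    theta τ 0 0 (z + Pi.single j 1) = theta τ 0 0 z := by
  have h := theta_add_intVec (τ := τ) 0 (Pi.single j 1) z
  have h1 : (fun i => ((Pi.single j 1 : Fin g → ℤ) i : ℂ)) = Pi.single j 1 := by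
    ext i
    by_cases hij : i = j
    · subst hij; simp
    · simp [hij]
  rw [h1] at h
  simpa using h

theorem thetaDir_zero_add_single (hτ : (τ.map Complex.im).PosDef) (v z : Fin g → ℂ) (j : Fin g) :
    thetaDir τ 0 v (z + Pi.single j 1) = thetaDir τ 0 v z := by
  have h1 := hasDerivAt_theta hτ 0 (z + Pi.single j 1) v 0
  have h2 := hasDerivAt_theta hτ 0 z v 0
  have h3 : (fun t : ℂ => theta τ 0 0 (z + Pi.single j 1 + t • v)) =
      fun t : ℂ => theta τ 0 0 (z + t • v) := by
    funext t
    rw [add_right_comm, theta_zero_add_single]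
  rw [h3] at h1
  simpa using h1.unique h2

/-- The logarithmic derivative of the theta function is not constant. -/
theorem eq_zero_of_thetaDir_proportional (hs : τ.IsSymm) (hτ : (τ.map Complex.im).PosDef)
    (v : Fin g → ℂ) (h : ∀ q p, thetaDir τ 0 v (q + p) * theta τ 0 0 q -
      thetaDir τ 0 v q * theta τ 0 0 (q + p) = 0) : v = 0 := by
  obtain ⟨q, hq⟩ := exists_theta_ne_zero hτ
  ext j
  set S : Fin g → ℂ := Pi.single j 1 with hS
  have hk : (fun i => (((Pi.single j 1 : Fin g → ℝ) i : ℝ) : ℂ)) = S := by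
    ext i
    by_cases hij : i = j
    · subst hij; simp [hS]
    · simp [hS, hij]
  set E : (Fin g → ℂ) → ℂ := fun z => Complex.exp (2 * (Real.pi : ℂ) * Complex.I *
      (1 / 2 * (S ⬝ᵥ (τ *ᵥ S)) + S ⬝ᵥ z)) with hE
  have hquasi : ∀ z, theta τ 0 0 z = E z * theta τ 0 0 (z + τ *ᵥ S) := by
    intro z
    have h1 := theta_add_upper hs 0 (Pi.single j 1) z
    rw [hk] at h1
    rw [hE, ← h1]
    have h2 := theta_add_int τ 0 0 z (Pi.single j 1)
    rw [← h2]
    congr 1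
    ext i
    by_cases hij : i = j
    · subst hij; simp
    · simp [hij]
  have hEd : HasDerivAt (fun t : ℂ => E (q + t • v))
      (E q * (2 * (Real.pi : ℂ) * Complex.I * v j)) 0 := by
    have h1 : HasDerivAt (fun t : ℂ => 2 * (Real.pi : ℂ) * Complex.I *
        (1 / 2 * (S ⬝ᵥ (τ *ᵥ S)) + (q j + t * v j))) (2 * (Real.pi : ℂ) * Complex.I * v j) 0 := by
      have := ((((hasDerivAt_id (0 : ℂ)).mul_const (v j)).const_add (q j)).const_add
        (1 / 2 * (S ⬝ᵥ (τ *ᵥ S)))).const_mul (2 * (Real.pi : ℂ) * Complex.I)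
      simpa using this
    have h2 := h1.cexp
    simpa [hE, hS] using h2
  have h1 := hEd.fun_mul (hasDerivAt_theta hτ 0 (q + τ *ᵥ S) v 0)
  have h2 : (fun t : ℂ => E (q + t • v) * theta τ 0 0 (q + τ *ᵥ S + t • v)) =
      fun t : ℂ => theta τ 0 0 (q + t • v) := by
    funext t
    rw [hquasi (q + t • v), add_right_comm]
  rw [h2] at h1
  have h3 := (hasDerivAt_theta hτ 0 q v 0).unique h1
  simp only [zero_smul, add_zero] at h3
  have h4 := h q (τ *ᵥ S)
  have h5 := hquasi q
  -- By quasi-periodicity the logarithmic derivatives at q and at q + τe_j differ by 2πi v_j; by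
  -- hypothesis they agree.
  have h6 : 2 * (Real.pi : ℂ) * Complex.I * theta τ 0 0 q ^ 2 * v j = 0 := by
    linear_combination (-theta τ 0 0 q) * h3 - E q * h4 +
      (-thetaDir τ 0 v q + 2 * (Real.pi : ℂ) * Complex.I * theta τ 0 0 q * v j) * h5 +
      2 * thetaDir τ 0 v q * h5
  have h7 : 2 * (Real.pi : ℂ) * Complex.I * theta τ 0 0 q ^ 2 ≠ 0 :=
    mul_ne_zero Complex.two_pi_I_ne_zero (pow_ne_zero _ hq)
  simpa using (mul_eq_zero.mp h6).resolve_left h7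

end ThetaDeriv

/-! ### Level N theta functions: base points and second order jets -/

section Level

variable {g : ℕ} {τ : Matrix (Fin g) (Fin g) ℂ}

/-- The space of theta functions of level `N` spanned by `θ[a, 0](Nτ, Nz + y)`. -/
noncomputable def levelSpan (τ : Matrix (Fin g) (Fin g) ℂ) (N : ℕ) (y : Fin g → ℂ) :
    Submodule ℂ ((Fin g → ℂ) → ℂ) :=
  Submodule.span ℂ (Set.range fun (a : Fin g → ZMod N) (z : Fin g → ℂ) =>
    theta ((N : ℂ) • τ) (levelChar N a) 0 ((N : ℂ) • z + y))

theorem theta_eq_theta_levelChar {N : ℕ} [NeZero N] (T : Matrix (Fin g) (Fin g) ℂ)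
    (k : Fin g → ℤ) :
    theta T (fun i => (k i : ℝ) / N) 0 = theta T (levelChar N fun i => (k i : ZMod N)) 0 := by
  funext z
  rw [← theta_add_int T (levelChar N fun i => (k i : ZMod N)) 0 z fun i => k i / N]
  congr 1
  funext i
  have hN : (N : ℝ) ≠ 0 := Nat.cast_ne_zero.mpr (NeZero.ne N)
  have h1 : (((k i : ZMod N).val : ℕ) : ℤ) = k i % N := ZMod.val_intCast _
  have h2 : ((((k i : ZMod N).val : ℕ) : ℤ) : ℝ) + N * ((k i / N : ℤ) : ℝ) = k i := by
    rw [h1]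
    exact_mod_cast Int.emod_add_mul_ediv (k i) N
  simp only [levelChar]
  rw [← h2]
  push_cast
  field_simp

theorem theta_mem_levelSpan_one (x : Fin g → ℂ) :
    (fun z => theta τ 0 0 (z + x)) ∈ levelSpan τ 1 x := by
  refine Submodule.subset_span ⟨0, ?_⟩
  funext z
  have : levelChar 1 (0 : Fin g → ZMod 1) = 0 := by
    ext i
    simp [levelChar]
  simp [this]

/-- In the multiplication formula the second factor has argument (Nz + y) - N(z + x) = y - Nx, free
of z, so it serves as a scalar coefficient. -/
theorem theta_mul_mem_levelSpan (hτ : (τ.map Complex.im).PosDef) {N : ℕ} (hN : 0 < N)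
    (x y : Fin g → ℂ) {f : (Fin g → ℂ) → ℂ} (hf : f ∈ levelSpan τ N y) :
    (fun z => theta τ 0 0 (z + x) * f z) ∈ levelSpan τ (N + 1) (x + y) := by
  have : NeZero N := ⟨hN.ne'⟩
  induction hf using Submodule.span_induction with
  | mem f hf =>
    obtain ⟨a, rfl⟩ := hf
    have key : (fun z => theta τ 0 0 (z + x) *
        theta ((N : ℂ) • τ) (levelChar N a) 0 ((N : ℂ) • z + y)) =
        ∑ j : Fin g → Fin (N + 1),
          theta (((N * (N + 1) : ℕ) : ℂ) • τ)
            (fun i => (levelChar N a i - (0 : Fin g → ℝ) i - (j i : ℕ)) / (N + 1)) 0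
            (y - (N : ℂ) • x) •
          fun z => theta (((N + 1 : ℕ) : ℂ) • τ)
            (levelChar (N + 1) fun i => ((((a i).val : ℤ) + (j i : ℕ) : ℤ) : ZMod (N + 1))) 0
            (((N + 1 : ℕ) : ℂ) • z + (x + y)) := by
      funext z
      rw [theta_mul_theta hτ hN, Finset.sum_apply]
      refine Finset.sum_congr rfl fun j _ => ?_
      rw [Pi.smul_apply, smul_eq_mul, mul_comm, ← theta_eq_theta_levelChar]
      have h1 : ((N : ℂ) • z + y - (N : ℂ) • (z + x)) = y - (N : ℂ) • x := by
        rw [smul_add]; abel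
      have h2 : z + x + ((N : ℂ) • z + y) = ((N + 1 : ℕ) : ℂ) • z + (x + y) := by
        push_cast
        rw [add_smul, one_smul]; abel
      have h3 : (fun i => ((0 : Fin g → ℝ) i + N * levelChar N a i + (j i : ℕ)) / ((N : ℝ) + 1)) =
          fun i => ((((a i).val : ℤ) + (j i : ℕ) : ℤ) : ℝ) / ((N + 1 : ℕ) : ℝ) := by
        funext i
        have : (N : ℝ) ≠ 0 := by exact_mod_cast hN.ne'
        simp only [levelChar, Pi.zero_apply]
        push_cast
        field_simp
        ring
      rw [h1, h2, h3]
    rw [key]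
    exact Submodule.sum_mem _ fun j _ =>
      Submodule.smul_mem _ _ (Submodule.subset_span ⟨_, rfl⟩)
  | zero =>
    convert (levelSpan τ (N + 1) (x + y)).zero_mem using 1
    funext z
    simp
  | add f h _ _ hf hh =>
    convert (levelSpan τ (N + 1) (x + y)).add_mem hf hh using 1
    funext z
    simp [mul_add]
  | smul c f _ hf =>
    convert (levelSpan τ (N + 1) (x + y)).smul_mem c hf using 1
    funext z
    simp only [Pi.smul_apply, smul_eq_mul]
    ring

theorem theta_mul_pow_mem_levelSpan (hτ : (τ.map Complex.im).PosDef) (k : ℕ) (q r : Fin g → ℂ) :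
    (fun z => theta τ 0 0 (z + q) * theta τ 0 0 (z + r) ^ k) ∈ levelSpan τ (k + 1) (q + k • r) := by
  induction k with
  | zero => simpa using theta_mem_levelSpan_one (τ := τ) q
  | succ k ih =>
    have h := theta_mul_mem_levelSpan hτ (Nat.succ_pos k) r _ ih
    have h1 : r + (q + k • r) = q + (k + 1) • r := by
      rw [succ_nsmul]; abel
    rw [h1] at h
    convert h using 1
    funext z
    ring

/-- The theta functions of a given level at least two have no common zero. -/
theorem exists_theta_levelChar_ne_zero (hτ : (τ.map Complex.im).PosDef) {N : ℕ} (hN : 2 ≤ N)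
    (y : Fin g → ℂ) : ∃ a, theta ((N : ℂ) • τ) (levelChar N a) 0 y ≠ 0 := by
  obtain ⟨k, rfl⟩ : ∃ k, N = k + 1 + 1 := ⟨N - 2, by omega⟩
  by_contra! hzero
  have hspan : ∀ f ∈ levelSpan τ (k + 1 + 1) y, f 0 = 0 := by
    intro f hf
    induction hf using Submodule.span_induction with
    | mem f hf =>
      obtain ⟨a, rfl⟩ := hf
      simpa using hzero a
    | zero => rfl
    | add f h _ _ hf hh => simp [hf, hh]
    | smul c f _ hf => simp [hf]
  have hd := differentiable_theta hτ 0
  -- A common zero at y kills all products of translates whose shifts add up to y.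
  have hprod : ∀ r : Fin g → ℂ,
      theta τ 0 0 (y - (k + 1) • r) * theta τ 0 0 r ^ (k + 1) = 0 := by
    intro r
    have h := theta_mul_pow_mem_levelSpan hτ (k + 1) (y - (k + 1) • r) r
    rw [sub_add_cancel] at h
    have := hspan _ h
    simpa only [zero_add] using this
  obtain ⟨r, hr⟩ := exists_theta_ne_zero hτ
  rcases eq_zero_or_eq_zero_of_differentiable_mul (by fun_prop) (by fun_prop) hprod with h | h
  · refine hr ?_
    have hk : ((k : ℂ) + 1) ≠ 0 := by exact_mod_cast Nat.succ_ne_zero k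
    -- This shift makes the argument y - (k + 1)r' of the first factor equal to r.
    have h1 := h (((k : ℂ) + 1)⁻¹ • (y - r))
    rw [← Nat.cast_smul_eq_nsmul ℂ, smul_smul, Nat.cast_add, Nat.cast_one, mul_inv_cancel₀ hk,
      one_smul, sub_sub_cancel] at h1
    exact h1
  · exact hr (pow_eq_zero_iff (Nat.succ_ne_zero k) |>.mp (h r))

/-- The theta functions of a given level at least four separate second order jets along a line:
they do not all satisfy the same differential equation `f'' + μ f' + c f = 0` at a point. -/
theorem eq_zero_of_theta_levelChar_jet_eq_zero (hs : τ.IsSymm) (hτ : (τ.map Complex.im).PosDef)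
    {N : ℕ} (hN : 4 ≤ N) (y v : Fin g → ℂ) (μ c : ℂ)
    (h : ∀ a, deriv (deriv fun t : ℂ => theta ((N : ℂ) • τ) (levelChar N a) 0 (y + t • v)) 0 +
      μ * deriv (fun t : ℂ => theta ((N : ℂ) • τ) (levelChar N a) 0 (y + t • v)) 0 +
      c * theta ((N : ℂ) • τ) (levelChar N a) 0 y = 0) : v = 0 := by
  -- Four translates vary independently up to the sum condition; the other k share one shift.
  obtain ⟨k, rfl⟩ : ∃ k, N = k + 1 + 1 + 1 + 1 := ⟨N - 4, by omega⟩
  set N := k + 1 + 1 + 1 + 1 with hNdef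
  have hN0 : (N : ℂ) ≠ 0 := Nat.cast_ne_zero.mpr (by omega)
  have hT := posDef_natCast_smul hτ (Nat.succ_pos (k + 1 + 1 + 1))
  -- Functions in `levelSpan` involve Nz, so direction w in z is direction v in the argument of
  -- theta.
  set w : Fin g → ℂ := (N : ℂ)⁻¹ • v with hw
  have hNw : (N : ℂ) • w = v := by rw [hw, smul_smul, mul_inv_cancel₀ hN0, one_smul]
  have hspan : ∀ f ∈ levelSpan τ N y, Differentiable ℂ (fun t : ℂ => f (t • w)) ∧
      deriv (deriv fun t : ℂ => f (t • w)) 0 + μ * deriv (fun t : ℂ => f (t • w)) 0 +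
        c * f 0 = 0 := by
    intro f hf
    induction hf using Submodule.span_induction with
    | mem f hf =>
      obtain ⟨a, rfl⟩ := hf
      have h1 : (fun t : ℂ => theta ((N : ℂ) • τ) (levelChar N a) 0 ((N : ℂ) • t • w + y)) =
          fun t : ℂ => theta ((N : ℂ) • τ) (levelChar N a) 0 (y + t • v) := by
        funext t
        rw [smul_comm, hNw, add_comm]
      simp only [h1, smul_zero, zero_add]
      refine ⟨?_, h a⟩
      have := differentiable_theta hT (levelChar N a)
      fun_prop
    | zero => simp
    | add f f' _ _ hf hf' =>
      obtain ⟨hd, he⟩ := hf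
      obtain ⟨hd', he'⟩ := hf'
      have h1 : deriv (fun t : ℂ => (f + f') (t • w)) =
          fun t => deriv (fun t : ℂ => f (t • w)) t + deriv (fun t : ℂ => f' (t • w)) t :=
        funext fun t => deriv_fun_add (hd t) (hd' t)
      refine ⟨hd.add hd', ?_⟩
      rw [h1, deriv_fun_add (hd.deriv 0) (hd'.deriv 0), Pi.add_apply]
      linear_combination he + he'
    | smul b f _ hf =>
      obtain ⟨hd, he⟩ := hf
      have h1 : deriv (fun t : ℂ => (b • f) (t • w)) =
          fun t => b * deriv (fun t : ℂ => f (t • w)) t :=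
        funext fun t => deriv_const_mul b (hd t)
      refine ⟨hd.const_mul b, ?_⟩
      rw [h1, deriv_const_mul b (hd.deriv 0), Pi.smul_apply, smul_eq_mul]
      linear_combination b * he
  have hF := differentiable_theta hτ 0
  have hG := differentiable_thetaDir hτ 0 w
  have hFG : ∀ (z : Fin g → ℂ) (t : ℂ), HasDerivAt (fun t : ℂ => theta τ 0 0 (t • w + z))
      (thetaDir τ 0 w (t • w + z)) t := by
    intro z t
    simpa only [add_comm z] using hasDerivAt_theta hτ 0 z w t
  have hW := increment_eq_of_jet_eq_zero hF hG hFG (exists_theta_ne_zero hτ) k y (μ := μ) (c := c)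
    (by
      intro q₁ q₂ q₃ q₄ r hq
      have h1 := theta_mul_mem_levelSpan hτ (by omega) q₁ _ <|
        theta_mul_mem_levelSpan hτ (by omega) q₂ _ <|
        theta_mul_mem_levelSpan hτ (by omega) q₃ _ <| theta_mul_pow_mem_levelSpan hτ k q₄ r
      rw [hq] at h1
      have h2 := (hspan _ h1).2
      simpa only [zero_add, mul_assoc] using h2)
  have hw0 := eq_zero_of_thetaDir_proportional hs hτ w fun q p =>
    mul_eq_mul_of_increment_eq_pi hF hG theta_zero_add_single (thetaDir_zero_add_single hτ w)
      (exists_theta_ne_zero hτ) hW q p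
  rw [← hNw, hw0, smul_zero]

end Level

/-! ### Recovering a vector from its bivectors with a quadratic map -/

section LinearAlgebra

/-- A vector `F` is determined up to a scalar by the bivectors `F ∧ Q(v)`, if `Q` is a quadratic
map that is anisotropic modulo `F`, on a space of dimension at least two. -/
theorem exists_smul_eq_of_wedge_eq {V ι : Type*} [AddCommGroup V] [Module ℂ V] {F F' : ι → ℂ}
    (hF' : F' ≠ 0) {Q Q' : V → ι → ℂ} (v₁ v₂ : V)
    (hv : ∀ x y : ℂ, x • v₁ + y • v₂ = 0 → x = 0 ∧ y = 0)
    (hQ : ∃ B : ι → ℂ, ∀ (x y : ℂ) a,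
      Q (x • v₁ + y • v₂) a = x ^ 2 * Q v₁ a + x * y * B a + y ^ 2 * Q v₂ a)
    (haniso : ∀ v (l : ℂ), (∀ a, Q v a = l * F a) → v = 0)
    (hwedge : ∀ v, ∃ v', ∀ a b, Q v a * F b - F a * Q v b = Q' v' a * F' b - F' a * Q' v' b) :
    ∃ r : ℂ, r • F' = F := by
  by_contra! hne
  obtain ⟨β, hβ⟩ := Function.ne_iff.mp hF'
  simp only [Pi.zero_apply] at hβ
  obtain ⟨α, hα⟩ : ∃ α, F α * F' β - F β * F' α ≠ 0 := by
    by_contra! hall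
    refine hne (F β / F' β) (funext fun α => ?_)
    have := hall α
    simp only [Pi.smul_apply, smul_eq_mul]
    field_simp
    linear_combination -this
  obtain ⟨B, hB⟩ := hQ
  -- Wedging F ∧ Q(v) = F' ∧ Q'(v') with F' gives zero. In coordinates α, β, γ this puts Q(v) in the
  -- span of F and F'; if the (α, β) minor of F ∧ Q(v) also vanishes, Q(v) is a multiple of F.
  have hroot : ∀ v, Q v α * F β - F α * Q v β = 0 → v = 0 := by
    intro v hv0
    obtain ⟨v', hv'⟩ := hwedge v
    refine haniso v ((Q v α * F' β - Q v β * F' α) / (F α * F' β - F β * F' α)) fun γ => ?_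
    rw [div_mul_eq_mul_div, eq_div_iff hα]
    have h1 := hv' α β
    have h2 := hv' β γ
    have h3 := hv' γ α
    linear_combination F' γ * h1 + F' α * h2 + F' β * h3 - F' γ * hv0
  set r₁ := Q v₁ α * F β - F α * Q v₁ β with hr₁
  set r₀ := B α * F β - F α * B β with hr₀
  set r₂ := Q v₂ α * F β - F α * Q v₂ β with hr₂
  have hr₂0 : r₂ ≠ 0 := by
    intro h0
    have := hv 0 1 (by rw [hroot v₂ h0]; simp)
    exact one_ne_zero this.2
  -- The minor is a quadratic form on the plane of v₁ and v₂; over ℂ it vanishes at some v₁ + y v₂,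
  -- which is nonzero.
  obtain ⟨s, hs⟩ : ∃ s : ℂ, discrim r₂ r₀ r₁ = s * s := by
    obtain ⟨s, hs⟩ := IsAlgClosed.exists_pow_nat_eq (discrim r₂ r₀ r₁) (n := 2) two_pos
    exact ⟨s, by rw [← hs, sq]⟩
  obtain ⟨y, hy⟩ := exists_quadratic_eq_zero hr₂0 ⟨s, hs⟩
  have h0 : (1 : ℂ) • v₁ + y • v₂ = 0 := by
    refine hroot _ ?_
    rw [hB, hB]
    linear_combination hy
  exact one_ne_zero (hv 1 y h0).1

end LinearAlgebra

/-! ### Gradients of level 4n and shifted theta constants of level 2n -/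

section Gradient

variable {g : ℕ}

/-- The bilinear consequence of an addition formula, obtained by differentiating once in each
variable. -/
theorem wedge_eq_sum_of_addition {J : Type*} [Fintype J] {f f' h h' : ℂ → ℂ} {f'' h'' : ℂ}
    {X Y : J → ℂ → ℂ} {X' Y' : J → ℂ} (hf : ∀ t, HasDerivAt f (f' t) t)
    (hf' : HasDerivAt f' f'' 0) (hh : ∀ t, HasDerivAt h (h' t) t) (hh' : HasDerivAt h' h'' 0)
    (hX : ∀ j, HasDerivAt (X j) (X' j) 0) (hY : ∀ j, HasDerivAt (Y j) (Y' j) 0)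
    (hadd : ∀ t s, f (t + s) * h (t - s) = ∑ j, X j t * Y j s) :
    f'' * h 0 - f 0 * h'' = ∑ j, X' j * Y' j := by
  -- The s-derivative at 0 gives f'h - fh'. In its t-derivative the mixed terms f'h' cancel.
  have h1 : ∀ t, f' t * h t - f t * h' t = ∑ j, X j t * Y' j := by
    intro t
    have hl : HasDerivAt (fun s => f (t + s)) (f' t) 0 := by
      have := (hf (t + 0)).comp_const_add t 0
      simpa using this
    have hr : HasDerivAt (fun s => h (t - s)) (-h' t) 0 := by
      have := (hh (t - 0)).comp_const_sub t 0
      simpa using this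
    have hlr := hl.fun_mul hr
    have hsum : HasDerivAt (fun s => ∑ j, X j t * Y j s) (∑ j, X j t * Y' j) 0 :=
      HasDerivAt.fun_sum fun j _ => (hY j).const_mul (X j t)
    simp only [hadd] at hlr
    have := hlr.unique hsum
    simp only [add_zero, sub_zero] at this
    linear_combination this
  have hl := (hf'.fun_mul (hh 0)).fun_sub ((hf 0).fun_mul hh')
  have hsum : HasDerivAt (fun t => ∑ j, X j t * Y' j) (∑ j, X' j * Y' j) 0 :=
    HasDerivAt.fun_sum fun j _ => (hX j).mul_const (Y' j)
  simp only [h1] at hl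
  have := hl.unique hsum
  linear_combination this

theorem thetaDir_eq_deriv {T : Matrix (Fin g) (Fin g) ℂ} (hT : (T.map Complex.im).PosDef)
    (ε : Fin g → ℝ) (v z : Fin g → ℂ) :
    thetaDir T ε v z = deriv (fun t : ℂ => theta T ε 0 (z + t • v)) 0 := by
  have := (hasDerivAt_theta hT ε z v 0).deriv
  rw [this]
  simp

theorem thetaDir_add_intVec {T : Matrix (Fin g) (Fin g) ℂ} (hT : (T.map Complex.im).PosDef)
    (ε : Fin g → ℝ) (k : Fin g → ℤ) (v : Fin g → ℂ) :
    thetaDir T ε v (fun i => (k i : ℂ)) =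
      Complex.exp (2 * (Real.pi : ℂ) * Complex.I * ∑ i, (ε i : ℂ) * k i) * thetaDir T ε v 0 := by
  have hd := (differentiable_theta hT ε)
  rw [thetaDir_eq_deriv hT, thetaDir_eq_deriv hT, ← deriv_const_mul _ (by fun_prop)]
  congr 1
  funext t
  rw [← theta_add_intVec, zero_add, add_comm]

theorem thetaDir_eq_sum_thetaGrad (τ : SiegelUpperHalfSpace g) {m : ℕ} [NeZero m]
    (v : Fin g → ℂ) (k : Fin g → ℤ) :
    thetaDir ((m : ℂ) • τ.1) (fun i => (k i : ℝ) / m) v 0 =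
      (∑ i, v i • thetaGrad m τ i) fun i => (k i : ZMod m) := by
  have hT := posDef_natCast_smul τ.2.2 (NeZero.pos m)
  have hgrad : ∀ i a, thetaGrad m τ i a =
      thetaDir ((m : ℂ) • τ.1) (levelChar m a) (Pi.single i 1) 0 := by
    intro i a
    rw [thetaDir_eq_deriv hT, thetaGrad]
    congr 1
    funext t
    congr 1
    ext j
    by_cases hij : j = i
    · subst hij; simp
    · simp [hij]
  rw [thetaDir_eq_deriv hT, theta_eq_theta_levelChar, ← thetaDir_eq_deriv hT, Finset.sum_apply]
  simp only [Pi.smul_apply, hgrad, smul_eq_mul]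
  let L : (Fin g → ℂ) →ₗ[ℂ] ℂ :=
    { toFun := fun v => thetaDir ((m : ℂ) • τ.1) (levelChar m fun i => (k i : ZMod m)) v 0
      map_add' := fun v w => thetaDir_add hT _ v w 0
      map_smul' := fun c v => thetaDir_smul _ c v 0 }
  have := L.pi_apply_eq_sum_univ v
  simp only [smul_eq_mul] at this
  refine this.trans (Finset.sum_congr rfl fun i _ => ?_)
  have hi : (fun j => if i = j then (1 : ℂ) else 0) = Pi.single i 1 := by
    ext j
    simp [Pi.single_apply, eq_comm]
  rw [hi]
  rfl

/-- The upper characteristic of a shifted theta constant. -/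
noncomputable def shiftedChar (n : ℕ) (d : Fin g → ℤ) (a : Fin g → ZMod (2 * n)) : Fin g → ℝ :=
  fun i => levelChar (2 * n) a i + ((d i : ℝ) / 2) / (2 * n)

/-- The half-integral vector `c/2`. -/
noncomputable def halfVec (c : Fin g → ℤ) : Fin g → ℂ := fun i => (((c i : ℝ) / 2 : ℝ) : ℂ)

/-- The second derivatives of the theta functions whose values are the shifted theta constants. -/
noncomputable def shiftedSecondDeriv (n : ℕ) (c d : Fin g → ℤ) (τ : SiegelUpperHalfSpace g)
    (v : Fin g → ℂ) : (Fin g → ZMod (2 * n)) → ℂ :=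
  fun a => thetaDir₂ (((2 * n : ℕ) : ℂ) • τ.1) (shiftedChar n d a) v v (halfVec c)

theorem shiftedThetaConstants_eq (n : ℕ) (c d : Fin g → ℤ) (τ : SiegelUpperHalfSpace g)
    (a : Fin g → ZMod (2 * n)) : shiftedThetaConstants n c d τ a =
      theta (((2 * n : ℕ) : ℂ) • τ.1) (shiftedChar n d a) 0 (halfVec c) := by
  rw [shiftedThetaConstants, theta_lower, zero_add]
  rfl

theorem isSymm_natCast_smul (τ : SiegelUpperHalfSpace g) (N : ℕ) : ((N : ℂ) • τ.1).IsSymm :=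
  τ.2.1.smul _

/-- Shifting the upper characteristic is a translation up to a nonvanishing exponential, so this is
the absence of common zeros at level 2n ≥ 2. -/
theorem shiftedThetaConstants_ne_zero {n : ℕ} (hn : 0 < n) (c d : Fin g → ℤ)
    (τ : SiegelUpperHalfSpace g) : shiftedThetaConstants n c d τ ≠ 0 := by
  intro h0
  set s : Fin g → ℝ := fun i => ((d i : ℝ) / 2) / (2 * n)
  obtain ⟨a, ha⟩ := exists_theta_levelChar_ne_zero τ.2.2 (by omega : 2 ≤ 2 * n)
    (halfVec c + (((2 * n : ℕ) : ℂ) • τ.1) *ᵥ fun i => (s i : ℂ))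
  have h1 := congrFun h0 a
  rw [shiftedThetaConstants_eq, show shiftedChar n d a = levelChar (2 * n) a + s from rfl,
    theta_add_upper (isSymm_natCast_smul τ _)] at h1
  exact (mul_ne_zero (Complex.exp_ne_zero _) ha) h1

/-- Used to remove the exponential relating shifted characteristics to unshifted ones: it turns f₀''
= l f₀ at 0 into an equation with a first order term, whence the μ in the jet statement. -/
theorem jet_exp_mul_eq_zero {f f₀ f₁ f₂ : ℂ → ℂ} (hf₀ : ∀ t, HasDerivAt f₀ (f₁ t) t)
    (hf₁ : ∀ t, HasDerivAt f₁ (f₂ t) t) {b C l : ℂ} (hl : f₂ 0 = l * f₀ 0)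
    (hf : ∀ t, f t = C * Complex.exp (-(b * t)) * f₀ t) :
    deriv (deriv f) 0 + 2 * b * deriv f 0 + (b ^ 2 - l) * f 0 = 0 := by
  obtain rfl : f = fun t => C * Complex.exp (-(b * t)) * f₀ t := funext hf
  have hexp : ∀ t, HasDerivAt (fun t : ℂ => C * Complex.exp (-(b * t)))
      (-b * (C * Complex.exp (-(b * t)))) t := by
    intro t
    have h1 : HasDerivAt (fun t : ℂ => -(b * t)) (-b) t := by
      simpa using ((hasDerivAt_id t).const_mul b).fun_neg
    refine (h1.cexp.const_mul C).congr_deriv ?_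
    ring
  have hd₁ : ∀ t, HasDerivAt (fun t : ℂ => C * Complex.exp (-(b * t)) * f₀ t)
      (C * Complex.exp (-(b * t)) * (f₁ t - b * f₀ t)) t := fun t =>
    ((hexp t).fun_mul (hf₀ t)).congr_deriv (by ring)
  have hd₂ : ∀ t, HasDerivAt (fun t : ℂ => C * Complex.exp (-(b * t)) * (f₁ t - b * f₀ t))
      (C * Complex.exp (-(b * t)) * (f₂ t - 2 * b * f₁ t + b ^ 2 * f₀ t)) t := fun t =>
    ((hexp t).fun_mul ((hf₁ t).fun_sub ((hf₀ t).const_mul b))).congr_deriv (by ring)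
  rw [funext fun t => (hd₁ t).deriv, (hd₂ 0).deriv, hl]
  ring

/-- The second derivatives of theta functions with shifted characteristics are anisotropic modulo
the values. -/
theorem eq_zero_of_thetaDir₂_eq {τ : Matrix (Fin g) (Fin g) ℂ} (hs : τ.IsSymm)
    (hτ : (τ.map Complex.im).PosDef) {N : ℕ} (hN : 4 ≤ N) (s : Fin g → ℝ) (z v : Fin g → ℂ) (l : ℂ)
    (h : ∀ a, thetaDir₂ ((N : ℂ) • τ) (levelChar N a + s) v v z =
      l * theta ((N : ℂ) • τ) (levelChar N a + s) 0 z) : v = 0 := by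
  have hT := posDef_natCast_smul hτ (by omega : 0 < N)
  have hTs : ((N : ℂ) • τ).IsSymm := hs.smul _
  obtain ⟨T, hTdef⟩ : ∃ T, T = (N : ℂ) • τ := ⟨_, rfl⟩
  obtain ⟨S, hS⟩ : ∃ S : Fin g → ℂ, S = fun i => (s i : ℂ) := ⟨_, rfl⟩
  refine eq_zero_of_theta_levelChar_jet_eq_zero hs hτ hN (z + T *ᵥ S) v
    (2 * (2 * (Real.pi : ℂ) * Complex.I * (S ⬝ᵥ v)))
    ((2 * (Real.pi : ℂ) * Complex.I * (S ⬝ᵥ v)) ^ 2 - l) fun a => ?_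
  rw [← hTdef] at hT hTs ⊢
  simp only [← hTdef] at h
  have key := jet_exp_mul_eq_zero (f := fun t : ℂ => theta T (levelChar N a) 0 (z + T *ᵥ S + t • v))
    (b := 2 * (Real.pi : ℂ) * Complex.I * (S ⬝ᵥ v))
    (C := Complex.exp (-(2 * (Real.pi : ℂ) * Complex.I * (1 / 2 * (S ⬝ᵥ (T *ᵥ S)) + S ⬝ᵥ z))))
    (fun t => hasDerivAt_theta hT (levelChar N a + s) z v t)
    (fun t => hasDerivAt_thetaDir hT (levelChar N a + s) z v v t)
    (l := l) (by simpa using h a) (by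
      intro t
      rw [theta_add_upper hTs, ← hS, ← mul_assoc, ← Complex.exp_add, ← Complex.exp_add,
        add_right_comm z]
      have h3 : -(2 * (Real.pi : ℂ) * Complex.I * (1 / 2 * (S ⬝ᵥ (T *ᵥ S)) + S ⬝ᵥ z)) +
          -(2 * (Real.pi : ℂ) * Complex.I * (S ⬝ᵥ v) * t) + 2 * (Real.pi : ℂ) * Complex.I *
            (1 / 2 * (S ⬝ᵥ (T *ᵥ S)) + S ⬝ᵥ (z + t • v)) = 0 := by
        rw [dotProduct_add, dotProduct_smul, smul_eq_mul]
        ring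
      rw [h3, Complex.exp_zero, one_mul])
  simpa only [zero_smul, add_zero] using key

theorem eq_zero_of_shiftedSecondDeriv_eq {n : ℕ} (hn : 1 < n) (c d : Fin g → ℤ)
    (τ : SiegelUpperHalfSpace g) (v : Fin g → ℂ) (l : ℂ)
    (h : ∀ a, shiftedSecondDeriv n c d τ v a = l * shiftedThetaConstants n c d τ a) : v = 0 := by
  refine eq_zero_of_thetaDir₂_eq τ.2.1 τ.2.2 (by omega : 4 ≤ 2 * n)
    (fun i => ((d i : ℝ) / 2) / (2 * n)) (halfVec c) v l fun a => ?_
  have := h a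
  rw [shiftedThetaConstants_eq] at this
  exact this

/-- The index pairs of the addition formula from level `2n` to level `4n`. -/
def additionIndex (n : ℕ) (d : Fin g → ℤ) (a b : Fin g → ZMod (2 * n)) (j : Fin g → Fin 2) :
    (Fin g → ℤ) × (Fin g → ℤ) :=
  -- Numerators over 4n of half the sum and half the difference of the two characteristics, up to
  -- j/2. The two shifts δ/(2n) add to d/(2n), whose half is still in (1/4n)ℤ^g: this is where δ
  -- needs to be half-integral.
  (fun i => (b i).val + (a i).val + d i + 2 * n * (j i : ℕ),
    fun i => (a i).val - (b i).val - 2 * n * (j i : ℕ))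

/-- The sign in the addition formula from level `2n` to level `4n`. -/
noncomputable def additionSign (n : ℕ) (c d : Fin g → ℤ) (a b : Fin g → ZMod (2 * n))
    (j : Fin g → Fin 2) : ℂ :=
  -- The factor arising from translation by 2γ = c, an integral vector since γ is half-integral.
  Complex.exp (2 * (Real.pi : ℂ) * Complex.I *
    ∑ i, (((additionIndex n d a b j).1 i / (4 * n : ℕ) : ℝ) : ℂ) * c i)

/-- The gradients at level `4n` determine the bivectors formed by the shifted theta constants of
level `2n` and the second derivatives. -/
theorem shiftedSecondDeriv_wedge {n : ℕ} (hn : 0 < n) (c d : Fin g → ℤ)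
    (τ : SiegelUpperHalfSpace g) (v : Fin g → ℂ) (a b : Fin g → ZMod (2 * n)) :
    shiftedSecondDeriv n c d τ v a * shiftedThetaConstants n c d τ b -
      shiftedThetaConstants n c d τ a * shiftedSecondDeriv n c d τ v b =
    ∑ j, (additionSign n c d a b j * (∑ i, ((2 : ℂ) • v) i • thetaGrad (4 * n) τ i)
        fun i => ((additionIndex n d a b j).1 i : ZMod (4 * n))) *
      (∑ i, ((2 : ℂ) • v) i • thetaGrad (4 * n) τ i)
        fun i => ((additionIndex n d a b j).2 i : ZMod (4 * n)) := by
  have : NeZero (4 * n) := ⟨by omega⟩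
  have hn0 : (n : ℝ) ≠ 0 := by exact_mod_cast hn.ne'
  have hT := posDef_natCast_smul τ.2.2 (by omega : 0 < 2 * n)
  have hT' := posDef_natCast_smul τ.2.2 (by omega : 0 < 4 * n)
  have hX : ∀ (k : Fin g → ℤ) (p : Fin g → ℂ), HasDerivAt
      (fun t : ℂ => theta (((4 * n : ℕ) : ℂ) • τ.1) (fun i => (k i : ℝ) / (4 * n : ℕ)) 0
        (p + t • ((2 : ℂ) • v)))
      (thetaDir (((4 * n : ℕ) : ℂ) • τ.1) (fun i => (k i : ℝ) / (4 * n : ℕ)) ((2 : ℂ) • v) p) 0 := by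
    intro k p
    simpa using hasDerivAt_theta hT' (fun i => (k i : ℝ) / (4 * n : ℕ)) p ((2 : ℂ) • v) 0
  have key := wedge_eq_sum_of_addition
    (fun t => hasDerivAt_theta hT (shiftedChar n d a) (halfVec c) v t)
    (hasDerivAt_thetaDir hT (shiftedChar n d a) (halfVec c) v v 0)
    (fun t => hasDerivAt_theta hT (shiftedChar n d b) (halfVec c) v t)
    (hasDerivAt_thetaDir hT (shiftedChar n d b) (halfVec c) v v 0)
    (fun j => hX (additionIndex n d a b j).1 fun i => (c i : ℂ))
    (fun j => hX (additionIndex n d a b j).2 0) (by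
      intro t s
      -- The case N = 1: the sum and difference of the arguments are c + 2tv and 2sv, hence the
      -- direction 2v.
      have h1 := theta_mul_theta hT one_pos (shiftedChar n d b) (shiftedChar n d a)
        (halfVec c + (t - s) • v) (halfVec c + (t + s) • v)
      rw [Nat.cast_one, one_smul, one_smul, mul_comm] at h1
      rw [h1]
      refine Finset.sum_congr rfl fun j _ => ?_
      have e1 : ((1 + 1 : ℕ) : ℂ) • ((2 * n : ℕ) : ℂ) • τ.1 = ((4 * n : ℕ) : ℂ) • τ.1 := by
        rw [smul_smul]; congr 1; push_cast; ring
      have e2 : ((1 * (1 + 1) : ℕ) : ℂ) • ((2 * n : ℕ) : ℂ) • τ.1 = ((4 * n : ℕ) : ℂ) • τ.1 := by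
        rw [smul_smul]; congr 1; push_cast; ring
      have e3 : halfVec c + (t - s) • v + (halfVec c + (t + s) • v) =
          (fun i => (c i : ℂ)) + t • ((2 : ℂ) • v) := by
        ext i
        simp only [halfVec, Pi.add_apply, Pi.smul_apply, smul_eq_mul]
        push_cast
        ring
      have e4 : halfVec c + (t + s) • v - (halfVec c + (t - s) • v) = 0 + s • ((2 : ℂ) • v) := by
        ext i
        simp only [Pi.add_apply, Pi.sub_apply, Pi.smul_apply, smul_eq_mul, Pi.zero_apply]
        ring
      have e5 : (fun i => (shiftedChar n d b i + ((1 : ℕ) : ℝ) * shiftedChar n d a i + (j i : ℕ)) /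
          (((1 : ℕ) : ℝ) + 1)) =
          fun i => ((additionIndex n d a b j).1 i : ℝ) / ((4 * n : ℕ) : ℝ) := by
        ext i
        simp only [shiftedChar, levelChar, additionIndex]
        push_cast
        field_simp
        ring
      have e6 : (fun i => (shiftedChar n d a i - shiftedChar n d b i - (j i : ℕ)) /
          (((1 : ℕ) : ℝ) + 1)) =
          fun i => ((additionIndex n d a b j).2 i : ℝ) / ((4 * n : ℕ) : ℝ) := by
        ext i
        simp only [shiftedChar, levelChar, additionIndex]
        push_cast
        field_simp
        ring
      rw [e1, e2, e3, e4, e5, e6])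
  simp only [zero_smul, add_zero] at key
  rw [shiftedThetaConstants_eq, shiftedThetaConstants_eq]
  refine key.trans (Finset.sum_congr rfl fun j _ => ?_)
  rw [thetaDir_add_intVec hT', thetaDir_eq_sum_thetaGrad, thetaDir_eq_sum_thetaGrad]
  rfl

/-- A relation with coefficients u makes F ∧ Q(u/2) vanish, so Q(u/2) is a multiple of F and
anisotropy gives u = 0. -/
theorem linearIndependent_thetaGrad {n : ℕ} (hn : 1 < n) (τ : SiegelUpperHalfSpace g) :
    LinearIndependent ℂ (thetaGrad (4 * n) τ) := by
  rw [Fintype.linearIndependent_iff]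
  intro u hu i
  set v : Fin g → ℂ := (2 : ℂ)⁻¹ • u with hv
  have hv2 : (2 : ℂ) • v = u := by rw [hv, smul_smul, mul_inv_cancel₀ two_ne_zero, one_smul]
  have hwedge := shiftedSecondDeriv_wedge (by omega : 0 < n) 0 0 τ v
  simp only [hv2, hu, Pi.zero_apply, mul_zero, Finset.sum_const_zero] at hwedge
  obtain ⟨b, hb⟩ := Function.ne_iff.mp (shiftedThetaConstants_ne_zero (by omega : 0 < n) 0 0 τ)
  simp only [Pi.zero_apply] at hb
  have hv0 := eq_zero_of_shiftedSecondDeriv_eq hn 0 0 τ v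
    (shiftedSecondDeriv n 0 0 τ v b / shiftedThetaConstants n 0 0 τ b) fun a => by
      rw [div_mul_eq_mul_div, eq_div_iff hb]
      linear_combination hwedge a b
  rw [← hv2, hv0]
  simp

/-- Equality of the gradient maps forces the shifted theta constants to be proportional. -/
theorem exists_smul_shiftedThetaConstants_eq (hg : 2 ≤ g) {n : ℕ} (hn : 1 < n) (c d : Fin g → ℤ)
    (τ τ' : SiegelUpperHalfSpace g) (h : gradientMap (4 * n) τ = gradientMap (4 * n) τ') :
    ∃ r : ℂ, r • shiftedThetaConstants n c d τ' = shiftedThetaConstants n c d τ := by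
  have hT := posDef_natCast_smul τ.2.2 (by omega : 0 < 2 * n)
  refine exists_smul_eq_of_wedge_eq (shiftedThetaConstants_ne_zero (by omega) c d τ')
    (Q := shiftedSecondDeriv n c d τ) (Q' := shiftedSecondDeriv n c d τ')
    -- Two coordinate directions span the plane required by the quadratic argument; they exist
    -- because g ≥ 2.
    (Pi.single ⟨0, by omega⟩ 1) (Pi.single ⟨1, by omega⟩ 1) ?_
    ⟨_, fun x y a => thetaDir₂_smul_add_smul hT (shiftedChar n d a) x y _ _ (halfVec c)⟩
    (eq_zero_of_shiftedSecondDeriv_eq hn c d τ) ?_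
  · intro x y hxy
    exact ⟨by
      simpa [Pi.single_apply, Fin.ext_iff] using congrFun hxy ⟨0, by omega⟩, by
      simpa [Pi.single_apply, Fin.ext_iff] using congrFun hxy ⟨1, by omega⟩⟩
  · intro v
    have hmem : ∑ i, ((2 : ℂ) • v) i • thetaGrad (4 * n) τ i ∈ gradientMap (4 * n) τ' := by
      rw [← h]
      exact Submodule.sum_mem _ fun i _ =>
        Submodule.smul_mem _ _ (Submodule.subset_span ⟨i, rfl⟩)
    obtain ⟨u, hu⟩ := (Submodule.mem_span_range_iff_exists_fun ℂ).mp hmem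
    -- The same vector of Φ is written in the rows of τ' with coefficients u; the half compensates
    -- the direction 2v.
    refine ⟨(2 : ℂ)⁻¹ • u, fun a b => ?_⟩
    rw [shiftedSecondDeriv_wedge (by omega) c d τ, shiftedSecondDeriv_wedge (by omega) c d τ',
      smul_smul, mul_inv_cancel₀ two_ne_zero, one_smul, hu]

end Gradient

theorem shiftedThetaConstants_zero_zero {g : ℕ} (n : ℕ) (τ : SiegelUpperHalfSpace g) :
    shiftedThetaConstants n 0 0 τ = thetaConstants (2 * n) τ := by
  funext a
  simp only [shiftedThetaConstants, thetaConstants, Pi.zero_apply, Int.cast_zero, zero_div,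
    add_zero]
  rfl

theorem mainTheorem3 (g n : ℕ) (hg : 2 ≤ g) (hn : 1 < n) :
    -- the gradient map of level `4n` takes values in the Grassmannian of `g`-planes
    (∀ τ : SiegelUpperHalfSpace g, Module.finrank ℂ (gradientMap (4 * n) τ) = g) ∧
    ∃ (hpt : ∀ (c d : Fin g → ℤ) (τ : SiegelUpperHalfSpace g),
          shiftedThetaConstants n c d τ ≠ 0)
      (hTh : ∀ τ : SiegelUpperHalfSpace g, thetaConstants (2 * n) τ ≠ 0),
      (∀ (c d : Fin g → ℤ) (τ τ' : SiegelUpperHalfSpace g),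
        gradientMap (4 * n) τ = gradientMap (4 * n) τ' →
          Projectivization.mk ℂ (shiftedThetaConstants n c d τ) (hpt c d τ) =
            Projectivization.mk ℂ (shiftedThetaConstants n c d τ') (hpt c d τ')) ∧
      (∀ τ : SiegelUpperHalfSpace g,
        Projectivization.mk ℂ (shiftedThetaConstants n 0 0 τ) (hpt 0 0 τ) =
          Projectivization.mk ℂ (thetaConstants (2 * n) τ) (hTh τ)) := by
  have hn0 : 0 < n := by omega
  have hpt : ∀ (c d : Fin g → ℤ) (τ : SiegelUpperHalfSpace g),
      shiftedThetaConstants n c d τ ≠ 0 := fun c d τ => shiftedThetaConstants_ne_zero hn0 c d τ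
  refine ⟨fun τ => ?_, hpt, fun τ => ?_, fun c d τ τ' h => ?_, fun τ => ?_⟩
  · exact (finrank_span_eq_card (linearIndependent_thetaGrad hn τ)).trans (Fintype.card_fin g)
  · rw [← shiftedThetaConstants_zero_zero]
    exact hpt 0 0 τ
  · exact (Projectivization.mk_eq_mk_iff' ℂ _ _ _ _).mpr
      (exists_smul_shiftedThetaConstants_eq hg hn c d τ τ' h)
  · exact (Projectivization.mk_eq_mk_iff' ℂ _ _ _ _).mpr
      ⟨1, by rw [one_smul, shiftedThetaConstants_zero_zero]⟩
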